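/- **Setting.** Let $\mathcal S,\mathcal A$ be finite sets ($\mathcal A\neq\emptyset$), $P$ a transition kernel, $\rho$ an initial distribution with $\rho(s)\ge\rho_{\min}>0$ for all $s$, and $\gamma\in(0,1)$. For a stationary policy $\pi$ let $\lambda^\pi\in\mathbb R^{\mathcal S\times\mathcal A}$, $\lambda^\pi(s,a)=\sum_{t\ge0}\gamma^t\,\mathbb P_{\rho,\pi}(s_t=s,a_t=a)$, let $\lambda^\pi_H$ be the same sum over $t<H$, and let $\Lambda=\{\lambda^\pi\}$ over all stationary policies. Let $\pi_\theta(a|s)\propto\exp\psi(s,a;\theta)$, $\theta\in\mathbb R^d$, $\lambda(\theta)=\lambda^{\pi_\theta}$, let $\phi:\mathcal S\times\mathcal A\to\mathbb R^m$ be a feature map, $V=\{\langle\phi(\cdot),\omega\rangle:\omega\in\mathbb R^m\}$, and $F:\mathbb R^{\mathcal S\times\mathcal A}\to\mathbb R$. Put $L_\theta(\omega)=\mathbb E_{s\sim\rho,a\sim\mathcal U(\mathcal A)}[(\lambda_H^{\pi_\theta}(s,a)-\langle\phi(s,a),\omega\rangle)^2]$, $\omega_*(\theta)\in\arg\min L_\theta$,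 and, for a trajectory $\tau=(s_0,a_0,\dots,s_{H-1},a_{H-1})$, $g(\tau,\theta,r)=\sum_{t<H}\big(\sum_{t\le h<H}\gamma^h r(s_h,a_h)\big)\nabla\log\pi_\theta(a_t|s_t)$. **Assumptions.** (1) $\psi(s,a;\cdot)$ is $C^2$ with $\|\nabla\psi\|\le l_\psi$, $\|\nabla^2\psi\|\le L_\psi$. (2) $F$ is differentiable at the points of $\Lambda\cup V$; $\|\nabla F\|_\infty\le l_\lambda$ on $\Lambda$; and for all $\lambda,\lambda'\in\Lambda\cup V$, $\|\nabla F(\lambda)-\nabla F(\lambda')\|_\infty\le L_\lambda\|\lambda-\lambda'\|_2$ and $\|\nabla F(\lambda)-\nabla F(\lambda')\|_\infty\le L_{\lambda,\infty}\|\lambda-\lambda'\|_1$. (3) $\|\phi(s,a)\|\le B$ and $\mathbb E_{s\sim\rho,a\sim\mathcal U(\mathcal A)}[\phi(s,a)\phi(s,a)^T]\succcurlyeq\mu I$. All of $l_\psi,L_\psi,l_\lambda,L_\lambda,L_{\lambda,\infty},B,\mu$ are positive. (4) $F(\lambda(\theta))\le F(\lambda(\theta_0))+\Delta$ for all $\theta$.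 **Algorithm.** Regression subroutine for $\theta$: from $\omega_0=0$, for $k<K$ draw $s\sim\rho$, $a\sim\mathcal U(\mathcal A)$ and an independent trajectory $(s_h,a_h)_{h<H}$ of $\pi_\theta$, and set $\omega_{k+1}=\omega_k-2\beta\big(\langle\phi(s,a),\omega_k\rangle-\sum_{h<H}\gamma^h\mathbf 1\{(s_h,a_h)=(s,a)\}\big)\phi(s,a)$ with $\beta=1/(8B^2)$; return $\hat\omega_\theta=\frac1K\sum_{k=1}^K\omega_k$. Main method: $r_{-1}=\nabla F(\langle\phi(\cdot),\hat\omega_{\theta_0}\rangle)$; for $t=0,1,\dots,T-1$ run the subroutine afresh at $\theta_t$, put $r_t=\nabla F(\langle\phi(\cdot),\hat\omega_{\theta_t}\rangle)$, draw $N$ independent trajectories $\tau_t^{(i)}$ of length $H$ of $\pi_{\theta_t}$, and set $\theta_{t+1}=\theta_t+\frac\alpha N\sum_{i=1}^N g(\tau_t^{(i)},\theta_t,r_{t-1})$. Let $\bar\theta_T$ be uniform on $\{\theta_1,\dots,\theta_T\}$. **Claim.** There are $\alpha_0,c_H>0$, depending only on $\gamma,l_\psi,L_\psi,l_\lambda,L_\lambda,L_{\lambda,\infty}$,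 such that for every step size $0<\alpha\le\alpha_0$ and all $c,c'>0$ there is $C>0$, depending only on these quantities and on $\alpha,|\mathcal A|,m,\rho_{\min},B,\mu,\Delta,c,c'$, with the following property. In every problem as above with these constants, $\theta\mapsto F(\lambda(\theta))$ is differentiable and, for every $\varepsilon>0$ and all integers $T,N,K,H\ge1$ with $T,N,K\ge c\,\varepsilon^{-2}$ and $H\ge c_H\log(1/\varepsilon)$: (a) if $\mathbb E[L_{\theta_t}(\omega_*(\theta_t))]\le\varepsilon_{\rm approx}$ for all $0\le t<T$, then $$\mathbb E\,\|\nabla_\theta F(\lambda(\bar\theta_T))\|\le C\varepsilon+C\sqrt{\varepsilon_{\rm approx}};$$ (b) if moreover $\varepsilon\le\frac12$, $T,N,K\le c'\varepsilon^{-2}$ and $H\le c'\log(1/\varepsilon)$ (so that $T,N,K=O(\varepsilon^{-2})$ and $H=O(\log\frac1\varepsilon)$), then $T(K+N)H\le C\varepsilon^{-4}\log(1/\varepsilon)$, and the total number of state-action pairs sampled by the method is, in every run, at most $C\varepsilon^{-4}\log(1/\varepsilon)$, i.e. $\tilde O(\varepsilon^{-4})$. -/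

import Mathlib

open MeasureTheory

namespace GenUtilityRL

noncomputable section

/-- `ℝ^n` with its Euclidean norm. -/
abbrev E (n : ℕ) : Type := EuclideanSpace ℝ (Fin n)

/-- The data of the problem: a discounted MDP with finite state space `S` and action space `A`
(transition kernel `P`, initial distribution `ρ`, discount factor `γ`), a utility `F` of the
occupancy measure, seen as a vector of `ℝ^(S × A)`, the function `ψ` that defines the softmax
parametrization by `θ ∈ ℝ^d`, and a feature map `φ` with values in `ℝ^m`. -/
structure Problem (S A : Type*) [Fintype S] [Fintype A] (d m : ℕ) where
  P : S → A → PMF S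
  ρ : PMF S
  γ : ℝ
  F : EuclideanSpace ℝ (S × A) → ℝ
  ψ : S → A → E d → ℝ
  φ : S × A → E m

/-- `π_θ(a|s) = exp ψ(s,a;θ) / ∑_{a'} exp ψ(s,a';θ)`. -/
def softmaxProb {A : Type*} [Fintype A] (v : A → ℝ) (a : A) : ℝ :=
  Real.exp (v a) / ∑ a' : A, Real.exp (v a')

theorem softmaxProb_sum {A : Type*} [Fintype A] [Nonempty A] (v : A → ℝ) :
    ∑ a : A, ENNReal.ofReal (softmaxProb v a) = 1 := by
  have hpos : 0 < ∑ a' : A, Real.exp (v a') :=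
    Finset.sum_pos (fun a _ => Real.exp_pos _) Finset.univ_nonempty
  simp only [softmaxProb]
  rw [← ENNReal.ofReal_sum_of_nonneg
    (fun a _ => div_nonneg (Real.exp_pos _).le hpos.le)]
  rw [← Finset.sum_div, div_self hpos.ne', ENNReal.ofReal_one]

/-- The softmax distribution on `A`. -/
def softmax {A : Type*} [Fintype A] [Nonempty A] (v : A → ℝ) : PMF A :=
  PMF.ofFintype (fun a => ENNReal.ofReal (softmaxProb v a)) (softmaxProb_sum v)

/-- One state of the averaged SGD recursion: the iterate `ω_k`, the sum `ω_1 + ⋯ + ω_k`, and the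
number of state-action pairs sampled so far. -/
structure SGDState (m : ℕ) where
  iterate : E m
  total : E m
  samples : ℕ

/-- One state of the policy gradient method: `θ_t`, the vector `r_{t-1}`, and the number of
state-action pairs sampled so far. -/
structure PGState (S A : Type*) [Fintype S] [Fintype A] (d : ℕ) where
  θ : E d
  r : EuclideanSpace ℝ (S × A)
  samples : ℕ

/-- `n` independent draws from `p`. -/
def iid {X : Type*} (p : PMF X) : (n : ℕ) → PMF (Fin n → X)
  | 0 => PMF.pure Fin.elim0
  | n + 1 => (iid p n).bind fun x => p.bind fun y => PMF.pure (Fin.snoc x y)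

namespace Problem

variable {S A : Type*} [Fintype S] [Fintype A] [DecidableEq S] [DecidableEq A] [Nonempty A]
  {d m : ℕ}

/-- The distribution of the next state after a trajectory `(s_0, a_0, …, s_{n-1}, a_{n-1})`. -/
def nextState (M : Problem S A d m) : {n : ℕ} → (Fin n → S × A) → PMF S
  | 0, _ => M.ρ
  | n + 1, τ => M.P (τ (Fin.last n)).1 (τ (Fin.last n)).2

/-- The law of the trajectory `(s_0, a_0, …, s_{H-1}, a_{H-1})` of length `H` generated from the
initial distribution by the stationary policy `π`. -/
def trajLaw (M : Problem S A d m) (π : S → PMF A) : (H : ℕ) → PMF (Fin H → S × A)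
  | 0 => PMF.pure Fin.elim0
  | H + 1 => (M.trajLaw π H).bind fun τ => (M.nextState τ).bind fun s => (π s).bind fun a =>
      PMF.pure (Fin.snoc τ (s, a))

/-- The law of `(s_t, a_t)` under the policy `π`. -/
def pairLaw (M : Problem S A d m) (π : S → PMF A) (t : ℕ) : PMF (S × A) :=
  (M.trajLaw π (t + 1)).map fun τ => τ (Fin.last t)

/-- The occupancy measure `λ^π(s,a) = ∑_{t ≥ 0} γ^t ℙ(s_t = s, a_t = a)`. -/
def occ (M : Problem S A d m) (π : S → PMF A) : EuclideanSpace ℝ (S × A) :=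
  WithLp.toLp 2 fun p => ∑' t : ℕ, M.γ ^ t * (M.pairLaw π t p).toReal

/-- The truncated occupancy measure `λ_H^π(s,a) = ∑_{t < H} γ^t ℙ(s_t = s, a_t = a)`. -/
def occTrunc (M : Problem S A d m) (H : ℕ) (π : S → PMF A) : EuclideanSpace ℝ (S × A) :=
  WithLp.toLp 2 fun p => ∑ t ∈ Finset.range H, M.γ ^ t * (M.pairLaw π t p).toReal

/-- The softmax policy `π_θ`. -/
def policy (M : Problem S A d m) (θ : E d) : S → PMF A :=
  fun s => softmax fun a => M.ψ s a θ

/-- The objective `θ ↦ F(λ(θ))`, where `λ(θ)` is the occupancy measure of `π_θ`. -/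
def objective (M : Problem S A d m) (θ : E d) : ℝ := M.F (M.occ (M.policy θ))

/-- `∇_θ log π_θ(a|s)`. -/
def score (M : Problem S A d m) (θ : E d) (s : S) (a : A) : E d :=
  gradient (fun θ' : E d => Real.log (softmaxProb (fun a' => M.ψ s a' θ') a)) θ

/-- The policy gradient estimate
`g(τ,θ,r) = ∑_{t<H} (∑_{t ≤ h < H} γ^h r(s_h,a_h)) ∇ log π_θ(a_t|s_t)`. -/
def pgEstimate (M : Problem S A d m) {H : ℕ} (τ : Fin H → S × A) (θ : E d)
    (r : EuclideanSpace ℝ (S × A)) : E d :=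
  ∑ t : Fin H, (∑ h ∈ Finset.Ici t, M.γ ^ (h : ℕ) * r (τ h)) • M.score θ (τ t).1 (τ t).2

/-- The Monte Carlo estimate `∑_{h<H} γ^h 1{(s_h,a_h) = (s,a)}` of `λ_H(s,a)` from a
trajectory. -/
def mcOcc (M : Problem S A d m) {H : ℕ} (τ : Fin H → S × A) (p : S × A) : ℝ :=
  ∑ h : Fin H, if τ h = p then M.γ ^ (h : ℕ) else 0

/-- The law of `(s,a)` with `s ∼ ρ` and `a` uniform on `A`, independent of `s`. -/
def queryLaw (M : Problem S A d m) : PMF (S × A) :=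
  M.ρ.bind fun s => (PMF.uniformOfFintype A).bind fun a => PMF.pure (s, a)

/-- The linear approximation `(s,a) ↦ ⟨φ(s,a), ω⟩`. -/
def linApprox (M : Problem S A d m) (ω : E m) : EuclideanSpace ℝ (S × A) :=
  WithLp.toLp 2 fun p => inner ℝ (M.φ p) ω

/-- The expected regression loss
`L_θ(ω) = 𝔼_{s ∼ ρ, a ∼ U(A)} [(λ_H^{π_θ}(s,a) - ⟨φ(s,a), ω⟩)^2]`. -/
def regLoss (M : Problem S A d m) (H : ℕ) (θ : E d) (ω : E m) : ℝ :=
  ∑ p : S × A, (M.queryLaw p).toReal *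
    (M.occTrunc H (M.policy θ) p - inner ℝ (M.φ p) ω) ^ 2

/-- The law of the state of the SGD recursion for the loss `L_θ` after `k` iterations. An
iteration draws a query `(s,a)` and an independent trajectory of length `H` of the policy `π_θ`. -/
def sgdLaw (M : Problem S A d m) (ω₀ : E m) (β : ℝ) (H : ℕ) (θ : E d) :
    (k : ℕ) → PMF (SGDState m)
  | 0 => PMF.pure ⟨ω₀, 0, 0⟩
  | k + 1 => (M.sgdLaw ω₀ β H θ k).bind fun x => M.queryLaw.bind fun p =>
      (M.trajLaw (M.policy θ) H).bind fun τ =>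
        let grad : E m := (2 * (inner ℝ (M.φ p) x.iterate - M.mcOcc τ p)) • M.φ p
        let ω : E m := x.iterate - β • grad
        PMF.pure ⟨ω, x.total + ω, x.samples + (H + 1)⟩

/-- The joint law of the output `(1/K) ∑_{k=1}^K ω_k` of the averaged SGD subroutine and of the
number of state-action pairs that it samples. -/
def sgdOutput (M : Problem S A d m) (ω₀ : E m) (β : ℝ) (K H : ℕ) (θ : E d) : PMF (E m × ℕ) :=
  (M.sgdLaw ω₀ β H θ K).map fun x => ((1 / (K : ℝ)) • x.total, x.samples)

/-- The law of the state of the stochastic policy gradient method with linear approximation of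
the occupancy measure after `t` iterations, started at `θ₀`, with step size `α`, batch size `N`,
horizon `H`, and `K` steps of averaged SGD (started at `ω₀`, with step size `β`) in each call of
the regression subroutine. -/
def pgLaw (M : Problem S A d m) (θ₀ : E d) (α : ℝ) (N : ℕ) (ω₀ : E m) (β : ℝ) (K H : ℕ) :
    (t : ℕ) → PMF (PGState S A d)
  | 0 => (M.sgdOutput ω₀ β K H θ₀).bind fun w =>
      PMF.pure ⟨θ₀, gradient M.F (M.linApprox w.1), w.2⟩
  | t + 1 => (M.pgLaw θ₀ α N ω₀ β K H t).bind fun x =>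
      (M.sgdOutput ω₀ β K H x.θ).bind fun w =>
        (iid (M.trajLaw (M.policy x.θ) H) N).bind fun τ =>
          PMF.pure ⟨x.θ + (α / (N : ℝ)) • ∑ i : Fin N, M.pgEstimate (τ i) x.θ x.r,
            gradient M.F (M.linApprox w.1), x.samples + w.2 + N * H⟩

/-- The law of `θ_t`. -/
def iterateLaw (M : Problem S A d m) (θ₀ : E d) (α : ℝ) (N : ℕ) (ω₀ : E m) (β : ℝ) (K H : ℕ)
    (t : ℕ) : PMF (E d) :=
  (M.pgLaw θ₀ α N ω₀ β K H t).map PGState.θ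

/-- The law of `θ̄_T`, drawn uniformly at random from `{θ_1, …, θ_T}`. -/
def averageLaw (M : Problem S A d m) (θ₀ : E d) (α : ℝ) (N : ℕ) (ω₀ : E m) (β : ℝ) (K H : ℕ)
    (T : ℕ) (hT : 1 ≤ T) : PMF (E d) :=
  (PMF.uniformOfFinset (Finset.Icc 1 T) (Finset.nonempty_Icc.mpr hT)).bind
    fun t => M.iterateLaw θ₀ α N ω₀ β K H t

/-- The set `Λ` of the occupancy measures of all stationary policies. -/
def occSet (M : Problem S A d m) : Set (EuclideanSpace ℝ (S × A)) := Set.range M.occ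

/-- Regularity of the policy parametrization: every `ψ(s,a;·)` is twice continuously
differentiable, with gradient bounded by `lψ` and Hessian bounded by `Lψ` in spectral norm. -/
structure PolicyRegular (M : Problem S A d m) (lψ Lψ : ℝ) : Prop where
  contDiff : ∀ s a, ContDiff ℝ 2 (M.ψ s a)
  grad_le : ∀ s a θ, ‖gradient (M.ψ s a) θ‖ ≤ lψ
  hess_le : ∀ s a θ, ‖fderiv ℝ (gradient (M.ψ s a)) θ‖ ≤ Lψ

/-- Regularity of the utility: the gradient of `F` is bounded on `Λ` in sup norm by `lF`, and on
`Λ ∪ {⟨φ(·), ω⟩ : ω ∈ ℝ^m}` the function `F` is differentiable and its gradient is Lipschitz for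
the sup norm, with constant `LF` with respect to the Euclidean norm and with constant `LF₁` with
respect to the `ℓ¹`-norm. (The norm of `WithLp.ofLp x : S × A → ℝ` is the sup norm of `x`.) -/
structure UtilityRegular (M : Problem S A d m) (lF LF LF₁ : ℝ) : Prop where
  differentiableAt : ∀ x ∈ M.occSet ∪ Set.range M.linApprox, DifferentiableAt ℝ M.F x
  grad_le : ∀ x ∈ M.occSet, ‖WithLp.ofLp (gradient M.F x)‖ ≤ lF
  lipschitz_two : ∀ x ∈ M.occSet ∪ Set.range M.linApprox,
    ∀ y ∈ M.occSet ∪ Set.range M.linApprox,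
      ‖WithLp.ofLp (gradient M.F x - gradient M.F y)‖ ≤ LF * ‖x - y‖
  lipschitz_one : ∀ x ∈ M.occSet ∪ Set.range M.linApprox,
    ∀ y ∈ M.occSet ∪ Set.range M.linApprox,
      ‖WithLp.ofLp (gradient M.F x - gradient M.F y)‖ ≤ LF₁ * ∑ p : S × A, |x p - y p|

/-- The features are bounded by `B`, and their covariance
`𝔼_{s ∼ ρ, a ∼ U(A)} [φ(s,a) φ(s,a)ᵀ]` satisfies `⪰ μ I`. -/
structure FeatureRegular (M : Problem S A d m) (B μ : ℝ) : Prop where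
  norm_le : ∀ p, ‖M.φ p‖ ≤ B
  cov : ((∑ p : S × A, (M.queryLaw p).toReal •
    Matrix.vecMulVec (WithLp.ofLp (M.φ p)) (WithLp.ofLp (M.φ p)))
      - μ • (1 : Matrix (Fin m) (Fin m) ℝ)).PosSemidef

end Problem

end

end GenUtilityRL

open GenUtilityRL

/-!
By the log-derivative trick, the gradient of `θ ↦ ⟨λ(θ), r⟩` is the expectation of the estimate
`g(τ, θ, r)` as `H → ∞`, so with `r = ∇F(λ(θ))` it is the gradient of `F(λ(θ))`, which is Lipschitz
in `θ`.

Averaged constant-step SGD solves the regression: since the step is linear, a fixed linear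
combination of the sum of the errors `ω_j - ω_*` and the last iterate is a martingale, and the
second moments of its increments are bounded. Hence the mean squared error of the average is
`O(1 / K)`, up to the approximation error and the bias `γ^H` of the truncation.

The ascent step uses the vector `r_{t-1}`, computed from the previous parameter. The lag is paid for
by the potential `const · α · ‖r_{t-1} - ∇F(λ(θ_t))‖_∞² - F(λ(θ_t))`: the drift of `∇F(λ(θ))`
along one step is `O(‖θ_{t+1} - θ_t‖)`, which for small `α` is absorbed by the ascent of the
objective. The telescoped decrease of the potential bounds the average of `‖∇F(λ(θ_t))‖²`, and the
logarithmic horizon makes `γ^H ≤ ε²`.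
-/

namespace GenUtilityRL

noncomputable section

theorem norm_add_sq_le {V : Type*} [SeminormedAddCommGroup V] (x y : V) :
    ‖x + y‖ ^ 2 ≤ 2 * ‖x‖ ^ 2 + 2 * ‖y‖ ^ 2 :=
  calc ‖x + y‖ ^ 2 ≤ (‖x‖ + ‖y‖) ^ 2 := by gcongr; exact norm_add_le x y
    _ ≤ 2 * (‖x‖ ^ 2 + ‖y‖ ^ 2) := add_sq_le
    _ = 2 * ‖x‖ ^ 2 + 2 * ‖y‖ ^ 2 := mul_add _ _ _

/-- The expectation of `f` under `p`. It is a sum over the points of `p`, not an integral, so that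
no measurable structure is needed on `X`; it is used for distributions of finite support, for which
the sum converges. -/
def expect {X V : Type*} [NormedAddCommGroup V] [NormedSpace ℝ V] (p : PMF X) (f : X → V) : V :=
  ∑' x, (p x).toReal • f x

section Expectation

variable {X Y V W : Type*} [NormedAddCommGroup V] [NormedSpace ℝ V]
  [NormedAddCommGroup W] [NormedSpace ℝ W]

instance finite_support_pure (x : X) : Finite (PMF.pure x).support := by
  rw [PMF.support_pure]
  infer_instance

instance finite_support_bind (p : PMF X) (q : X → PMF Y) [Finite p.support]
    [∀ x, Finite (q x).support] : Finite (p.bind q).support := by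
  rw [PMF.support_bind]
  exact (Set.toFinite p.support).biUnion fun x _ => Set.toFinite _

instance finite_support_map (p : PMF X) (g : X → Y) [Finite p.support] :
    Finite (p.map g).support := by
  rw [PMF.support_map]
  infer_instance

theorem tsum_toReal (p : PMF X) : ∑' x, (p x).toReal = 1 := by
  rw [← ENNReal.tsum_toReal_eq p.apply_ne_top, p.tsum_coe, ENNReal.toReal_one]

theorem expect_eq_sum [Fintype X] (p : PMF X) (f : X → V) :
    expect p f = ∑ x, (p x).toReal • f x :=
  tsum_fintype _

theorem expect_pure (x : X) (f : X → V) : expect (PMF.pure x) f = f x := by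
  classical
  rw [expect, tsum_eq_single x fun y hy => by simp [PMF.pure_apply, hy]]
  simp

theorem expect_congr (p : PMF X) {f g : X → V} (h : ∀ x, f x = g x) : expect p f = expect p g :=
  congrArg (expect p) (funext h)

theorem expect_nonneg (p : PMF X) {f : X → ℝ} (h : ∀ x, 0 ≤ f x) : 0 ≤ expect p f :=
  tsum_nonneg fun x => mul_nonneg ENNReal.toReal_nonneg (h x)

theorem summable_toReal_smul (p : PMF X) [Finite p.support] (f : X → V) :
    Summable fun x => (p x).toReal • f x := by
  refine summable_of_hasFiniteSupport ((Set.toFinite p.support).subset fun x hx => ?_)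
  rw [PMF.mem_support_iff]
  intro h
  simp [h] at hx

theorem expect_bind (p : PMF X) (q : X → PMF Y) [Finite p.support] [∀ x, Finite (q x).support]
    (f : Y → V) : expect (p.bind q) f = expect p fun x => expect (q x) f := by
  set s := (Set.toFinite p.support).toFinset
  have apply_eq_zero : ∀ x ∉ s, p x = 0 := fun x hx => by
    simpa [s, PMF.mem_support_iff] using hx
  have bind_toReal (y : Y) : (p.bind q y).toReal = ∑ x ∈ s, (p x).toReal * (q x y).toReal := by
    rw [PMF.bind_apply, tsum_eq_sum fun x hx => by rw [apply_eq_zero x hx, zero_mul],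
      ENNReal.toReal_sum fun x _ => ENNReal.mul_ne_top (p.apply_ne_top x) ((q x).apply_ne_top y)]
    simp only [ENNReal.toReal_mul]
  calc expect (p.bind q) f
      = ∑' y, ∑ x ∈ s, (p x).toReal • (q x y).toReal • f y := by
        simp only [expect, bind_toReal, Finset.sum_smul, mul_smul]
    _ = ∑ x ∈ s, (p x).toReal • expect (q x) f := by
        rw [Summable.tsum_finsetSum fun x _ => (summable_toReal_smul (q x) f).const_smul _]
        exact Finset.sum_congr rfl fun x _ => (summable_toReal_smul (q x) f).tsum_const_smul _
    _ = expect p fun x => expect (q x) f :=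
        (tsum_eq_sum fun x hx => by simp [apply_eq_zero x hx]).symm

theorem expect_map (p : PMF X) (g : X → Y) [Finite p.support] (f : Y → V) :
    expect (p.map g) f = expect p fun x => f (g x) := by
  change expect (p.bind fun x => PMF.pure (g x)) f = _
  simp only [expect_bind, expect_pure]

theorem integral_toMeasure_eq_expect [MeasurableSpace X] [MeasurableSingletonClass X] (p : PMF X)
    [Finite p.support] (f : X → ℝ) : ∫ x, f x ∂p.toMeasure = expect p f := by
  have integrable : Integrable f p.toMeasure := by
    rw [← PMF.restrict_toMeasure_support p]
    exact IntegrableOn.of_finite (Set.toFinite p.support)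
  exact PMF.integral_eq_tsum p f integrable

variable (p : PMF X) [Finite p.support]

theorem expect_const (v : V) : (expect p fun _ => v) = v := by
  have summable : Summable fun x => (p x).toReal := by
    simpa using summable_toReal_smul p fun _ => (1 : ℝ)
  rw [expect, summable.tsum_smul_const, tsum_toReal, one_smul]

theorem expect_add (f g : X → V) : (expect p fun x => f x + g x) = expect p f + expect p g := by
  simp only [expect, smul_add]
  exact (summable_toReal_smul p f).tsum_add (summable_toReal_smul p g)

theorem expect_sub (f g : X → V) : (expect p fun x => f x - g x) = expect p f - expect p g := by
  simp only [expect, smul_sub]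
  exact (summable_toReal_smul p f).tsum_sub (summable_toReal_smul p g)

theorem expect_clm (L : V →L[ℝ] W) (f : X → V) : (expect p fun x => L (f x)) = L (expect p f) := by
  simp only [expect, L.map_tsum (summable_toReal_smul p f), map_smul]

theorem expect_smul (c : ℝ) (f : X → V) : (expect p fun x => c • f x) = c • expect p f :=
  expect_clm p (c • ContinuousLinearMap.id ℝ V) f

theorem expect_mul (c : ℝ) (f : X → ℝ) : (expect p fun x => c * f x) = c * expect p f :=
  expect_smul p c f

theorem expect_mono {f g : X → ℝ} (h : ∀ x, f x ≤ g x) : expect p f ≤ expect p g :=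
  (summable_toReal_smul p f).tsum_le_tsum
    (fun x => mul_le_mul_of_nonneg_left (h x) ENNReal.toReal_nonneg) (summable_toReal_smul p g)

theorem expect_le_const {f : X → ℝ} {c : ℝ} (h : ∀ x, f x ≤ c) : expect p f ≤ c :=
  (expect_mono p h).trans_eq (expect_const p c)

theorem norm_expect_le (f : X → V) : ‖expect p f‖ ≤ expect p fun x => ‖f x‖ := by
  have norm_smul_eq (x : X) : ‖(p x).toReal • f x‖ = (p x).toReal • ‖f x‖ := by
    rw [norm_smul, Real.norm_of_nonneg ENNReal.toReal_nonneg, smul_eq_mul]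
  simp only [expect, ← norm_smul_eq]
  refine norm_tsum_le_tsum_norm ?_
  simpa only [norm_smul_eq] using summable_toReal_smul p fun x => ‖f x‖

theorem norm_expect_le_const {f : X → V} {c : ℝ} (h : ∀ x, ‖f x‖ ≤ c) : ‖expect p f‖ ≤ c :=
  (norm_expect_le p f).trans (expect_le_const p h)

end Expectation

section SecondMoment

variable {X V : Type*} [NormedAddCommGroup V] [InnerProductSpace ℝ V]
  (p : PMF X) [Finite p.support]

theorem expect_inner (v : V) (f : X → V) :
    (expect p fun x => inner ℝ v (f x)) = inner ℝ v (expect p f) :=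
  expect_clm p (innerSL ℝ v) f

theorem expect_norm_add_sq (v : V) {f : X → V} (hf : expect p f = 0) :
    (expect p fun x => ‖v + f x‖ ^ 2) = ‖v‖ ^ 2 + expect p fun x => ‖f x‖ ^ 2 := by
  simp only [norm_add_sq_real, expect_add, expect_const, expect_mul, expect_inner, hf,
    inner_zero_right, mul_zero, add_zero]

theorem expect_sub_expect (f : X → V) : (expect p fun x => f x - expect p f) = 0 := by
  rw [expect_sub, expect_const, sub_self]

theorem expect_norm_sq_eq (f : X → V) :
    (expect p fun x => ‖f x‖ ^ 2) =
      ‖expect p f‖ ^ 2 + expect p fun x => ‖f x - expect p f‖ ^ 2 := by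
  simpa only [add_sub_cancel] using expect_norm_add_sq p (expect p f) (expect_sub_expect p f)

theorem norm_expect_sq_le (f : X → V) : ‖expect p f‖ ^ 2 ≤ expect p fun x => ‖f x‖ ^ 2 := by
  rw [expect_norm_sq_eq]
  exact le_add_of_nonneg_right (expect_nonneg p fun _ => sq_nonneg _)

theorem expect_norm_sub_expect_sq_le (f : X → V) :
    (expect p fun x => ‖f x - expect p f‖ ^ 2) ≤ expect p fun x => ‖f x‖ ^ 2 := by
  rw [expect_norm_sq_eq p f]
  exact le_add_of_nonneg_left (sq_nonneg _)

theorem sq_expect_le (f : X → ℝ) : expect p f ^ 2 ≤ expect p fun x => f x ^ 2 := by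
  simpa only [Real.norm_eq_abs, sq_abs] using norm_expect_sq_le p f

instance finite_support_iid : ∀ n, Finite (iid p n).support
  | 0 => finite_support_pure _
  | n + 1 => by
    have := finite_support_iid n
    unfold iid
    infer_instance

theorem expect_iid_norm_sum_sq {f : X → V} (hf : expect p f = 0) (n : ℕ) :
    (expect (iid p n) fun x => ‖∑ i, f (x i)‖ ^ 2) = n * expect p fun x => ‖f x‖ ^ 2 := by
  induction n with
  | zero => simp [iid, expect_pure]
  | succ n ih =>
    simp only [iid, expect_bind, expect_pure, Fin.sum_univ_castSucc, Fin.snoc_castSucc,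
      Fin.snoc_last, expect_norm_add_sq p _ hf, expect_add, ih, expect_const]
    push_cast
    ring

theorem expect_iid_norm_mean_sq {f : X → V} (hf : expect p f = 0) {n : ℕ} (hn : n ≠ 0) :
    (expect (iid p n) fun x => ‖(1 / n : ℝ) • ∑ i, f (x i)‖ ^ 2) =
      1 / n * expect p fun x => ‖f x‖ ^ 2 := by
  simp only [norm_smul, mul_pow, expect_mul, expect_iid_norm_sum_sq p hf, norm_div, norm_one,
    Real.norm_natCast]
  field_simp

theorem expect_iid {W : Type*} [NormedAddCommGroup W] [NormedSpace ℝ W] (f : X → W) (n : ℕ) :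
    (expect (iid p n) fun x => ∑ i, f (x i)) = n • expect p f := by
  induction n with
  | zero => simp [iid, expect_pure]
  | succ n ih =>
    simp only [iid, expect_bind, expect_pure, Fin.sum_univ_castSucc, Fin.snoc_castSucc,
      Fin.snoc_last, expect_add, ih, expect_const, succ_nsmul]

theorem expect_iid_norm_mean_sub_sq_le (f : X → V) (v : V) {n : ℕ} (hn : n ≠ 0) :
    (expect (iid p n) fun x => ‖(1 / n : ℝ) • ∑ i, f (x i) - v‖ ^ 2) ≤
      ‖expect p f - v‖ ^ 2 + 1 / n * expect p fun x => ‖f x‖ ^ 2 := by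
  have bias_add_noise (x : Fin n → X) : (1 / n : ℝ) • ∑ i, f (x i) - v =
      (expect p f - v) + (1 / n : ℝ) • ∑ i, (f (x i) - expect p f) := by
    rw [Finset.sum_sub_distrib, smul_sub, Finset.sum_const, Finset.card_univ, Fintype.card_fin,
      ← Nat.cast_smul_eq_nsmul ℝ, smul_smul, one_div_mul_cancel (Nat.cast_ne_zero.mpr hn), one_smul]
    abel
  have expect_noise :
      (expect (iid p n) fun x => (1 / n : ℝ) • ∑ i, (f (x i) - expect p f)) = 0 := by
    rw [expect_smul, expect_iid p fun x => f x - expect p f, expect_sub_expect, smul_zero,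
      smul_zero]
  simp only [bias_add_noise, expect_norm_add_sq _ _ expect_noise,
    expect_iid_norm_mean_sq p (expect_sub_expect p f) hn]
  gcongr
  exact expect_norm_sub_expect_sq_le p f

end SecondMoment

section LeastSquares

variable {Z V : Type*} [NormedAddCommGroup V] [InnerProductSpace ℝ V]

/-- The expected squared error `𝔼 (y - ⟨a, ω⟩)²` of the linear predictor `ω`. -/
def lsLoss (D : PMF Z) (a : Z → V) (y : Z → ℝ) (ω : V) : ℝ :=
  expect D fun z => (y z - inner ℝ (a z) ω) ^ 2

/-- The stochastic gradient `(⟨a, ω⟩ - y) a` of the loss `(⟨a, ω⟩ - y)² / 2`. -/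
def lsGrad (a : Z → V) (y : Z → ℝ) (ω : V) (z : Z) : V := (inner ℝ (a z) ω - y z) • a z

/-- The second moment operator `v ↦ 𝔼 ⟨a, v⟩ a` of the random vector `a`, which is the Hessian of
the expected loss. -/
def secondMoment (D : PMF Z) (a : Z → V) : V →L[ℝ] V :=
  expect D fun z => (innerSL ℝ (a z)).smulRight (a z)

variable (D : PMF Z) [Finite D.support] {a : Z → V} {y : Z → ℝ}

theorem secondMoment_apply (a : Z → V) (v : V) :
    secondMoment D a v = expect D fun z => inner ℝ (a z) v • a z := by
  simpa [secondMoment] using (expect_clm D (ContinuousLinearMap.apply ℝ V v)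
    fun z => (innerSL ℝ (a z)).smulRight (a z)).symm

theorem inner_secondMoment_self (a : Z → V) (v : V) :
    inner ℝ v (secondMoment D a v) = expect D fun z => inner ℝ (a z) v ^ 2 := by
  simp only [secondMoment_apply, ← expect_inner, inner_smul_right, real_inner_comm v, sq]

theorem expect_inner_sq_le {B : ℝ} (norm_le : ∀ z, ‖a z‖ ≤ B) (v : V) :
    (expect D fun z => inner ℝ (a z) v ^ 2) ≤ B ^ 2 * ‖v‖ ^ 2 := by
  refine expect_le_const D fun z => ?_
  rw [← mul_pow, ← sq_abs]
  gcongr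
  exact (abs_real_inner_le_norm _ _).trans (by gcongr; exact norm_le z)

theorem norm_secondMoment_apply_le {B : ℝ} (norm_le : ∀ z, ‖a z‖ ≤ B) (v : V) :
    ‖secondMoment D a v‖ ≤ B ^ 2 * ‖v‖ := by
  rw [secondMoment_apply]
  refine norm_expect_le_const D fun z => ?_
  calc ‖inner ℝ (a z) v • a z‖ ≤ (‖a z‖ * ‖v‖) * ‖a z‖ := by
        rw [norm_smul]
        gcongr
        exact norm_inner_le_norm _ _
    _ = ‖a z‖ ^ 2 * ‖v‖ := by ring
    _ ≤ B ^ 2 * ‖v‖ := by gcongr; exact norm_le z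

theorem le_norm_secondMoment_apply {μ : ℝ}
    (coercive : ∀ v, μ * ‖v‖ ^ 2 ≤ expect D fun z => inner ℝ (a z) v ^ 2) (v : V) :
    μ * ‖v‖ ≤ ‖secondMoment D a v‖ := by
  rcases (norm_nonneg v).eq_or_lt with hv | hv
  · rw [← hv, mul_zero]
    exact norm_nonneg _
  · have := (coercive v).trans_eq (inner_secondMoment_self D a v).symm
      |>.trans (real_inner_le_norm _ _)
    nlinarith

theorem lsLoss_add (w v : V) :
    lsLoss D a y (w + v) = lsLoss D a y w + 2 * inner ℝ v (expect D (lsGrad a y w)) +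
      expect D fun z => inner ℝ (a z) v ^ 2 := by
  have expand (z : Z) : (y z - inner ℝ (a z) (w + v)) ^ 2 =
      (y z - inner ℝ (a z) w) ^ 2 + 2 * inner ℝ v (lsGrad a y w z) + inner ℝ (a z) v ^ 2 := by
    rw [lsGrad, inner_smul_right, inner_add_right, real_inner_comm v]
    ring
  simp only [lsLoss, expand, expect_add, expect_mul, expect_inner]

theorem expect_lsGrad_eq_zero_of_forall_le {w : V} (hw : ∀ ω, lsLoss D a y w ≤ lsLoss D a y ω) :
    expect D (lsGrad a y w) = 0 := by
  set g := expect D (lsGrad a y w) with hg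
  have quadratic_nonneg (t : ℝ) :
      0 ≤ (expect D fun z => inner ℝ (a z) g ^ 2) * (t * t) + 2 * ‖g‖ ^ 2 * t + 0 := by
    have := hw (w + t • g)
    simp only [lsLoss_add, ← hg, inner_smul_left, inner_smul_right, real_inner_self_eq_norm_sq,
      mul_pow, expect_mul, conj_trivial] at this
    linarith
  have := discrim_le_zero quadratic_nonneg
  rw [discrim, mul_zero, sub_zero] at this
  simpa using this.antisymm (sq_nonneg _)

theorem lsLoss_le_add_norm_sub_sq {B : ℝ} (norm_le : ∀ z, ‖a z‖ ≤ B) {w : V}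
    (normal_eq : expect D (lsGrad a y w) = 0) (ω : V) :
    lsLoss D a y ω ≤ lsLoss D a y w + B ^ 2 * ‖ω - w‖ ^ 2 := by
  have := lsLoss_add D (a := a) (y := y) w (ω - w)
  rw [add_sub_cancel, normal_eq, inner_zero_right, mul_zero, add_zero] at this
  rw [this]
  gcongr
  exact expect_inner_sq_le D norm_le _

theorem expect_lsGrad {w : V} (normal_eq : expect D (lsGrad a y w) = 0) (ω : V) :
    expect D (lsGrad a y ω) = secondMoment D a (ω - w) := by
  have split (z : Z) : lsGrad a y ω z = inner ℝ (a z) (ω - w) • a z + lsGrad a y w z := by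
    rw [lsGrad, lsGrad, ← add_smul, inner_sub_right]
    ring_nf
  rw [expect_congr D split, expect_add, normal_eq, add_zero, secondMoment_apply]

theorem mul_norm_le_of_expect_lsGrad_eq_zero {B μ Y : ℝ} (norm_le : ∀ z, ‖a z‖ ≤ B)
    (coercive : ∀ v, μ * ‖v‖ ^ 2 ≤ expect D fun z => inner ℝ (a z) v ^ 2)
    (abs_le : ∀ z, |y z| ≤ Y) {w : V} (normal_eq : expect D (lsGrad a y w) = 0) :
    μ * ‖w‖ ≤ Y * B :=
  calc μ * ‖w‖ ≤ ‖secondMoment D a w‖ := le_norm_secondMoment_apply D coercive w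
    _ = ‖expect D (lsGrad a y 0)‖ := by
        rw [expect_lsGrad D normal_eq, zero_sub, map_neg, norm_neg]
    _ ≤ Y * B := norm_expect_le_const D fun z => by
        rw [lsGrad, inner_zero_right, zero_sub, norm_smul, norm_neg]
        exact mul_le_mul (abs_le z) (norm_le z) (norm_nonneg _) ((abs_nonneg _).trans (abs_le z))

/-- A least squares problem with covariates bounded by `B` and second moments `⪰ μ I`, for which `w`
solves the normal equations with residuals bounded by `σ`. -/
structure IsRegularLeastSquares (D : PMF Z) (a : Z → V) (y : Z → ℝ) (w : V) (B μ σ : ℝ) :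
    Prop where
  norm_le : ∀ z, ‖a z‖ ≤ B
  coercive : ∀ v, μ * ‖v‖ ^ 2 ≤ expect D fun z => inner ℝ (a z) v ^ 2
  normal_eq : expect D (lsGrad a y w) = 0
  residual_le : ∀ z, |inner ℝ (a z) w - y z| ≤ σ

namespace IsRegularLeastSquares

variable {D} {w : V} {B μ σ η : ℝ} (h : IsRegularLeastSquares D a y w B μ σ)

include h

theorem expect_norm_lsGrad_sq_le (ω : V) :
    (expect D fun z => ‖lsGrad a y ω z‖ ^ 2) ≤
      2 * B ^ 2 * ((expect D fun z => inner ℝ (a z) (ω - w) ^ 2) + σ ^ 2) := by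
  have norm_lsGrad_sq_le (z : Z) : ‖lsGrad a y ω z‖ ^ 2 ≤
      2 * B ^ 2 * (inner ℝ (a z) (ω - w) ^ 2 + σ ^ 2) := by
    have residual_sq_le : (inner ℝ (a z) w - y z) ^ 2 ≤ σ ^ 2 := by
      rw [← sq_abs]
      gcongr
      exact h.residual_le z
    calc ‖lsGrad a y ω z‖ ^ 2
        = (inner ℝ (a z) (ω - w) + (inner ℝ (a z) w - y z)) ^ 2 * ‖a z‖ ^ 2 := by
          rw [lsGrad, norm_smul, mul_pow, Real.norm_eq_abs, sq_abs, inner_sub_right]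
          ring
      _ ≤ (2 * (inner ℝ (a z) (ω - w) ^ 2 + (inner ℝ (a z) w - y z) ^ 2)) * ‖a z‖ ^ 2 := by
          gcongr
          exact add_sq_le
      _ ≤ (2 * (inner ℝ (a z) (ω - w) ^ 2 + σ ^ 2)) * B ^ 2 := by
          gcongr
          exact h.norm_le z
      _ = 2 * B ^ 2 * (inner ℝ (a z) (ω - w) ^ 2 + σ ^ 2) := by ring
  refine (expect_mono D norm_lsGrad_sq_le).trans_eq ?_
  rw [expect_mul, expect_add, expect_const]

theorem expect_norm_step_sub_sq_le (hη : 0 ≤ η) (hηB : η * B ^ 2 ≤ 1 / 4) (ω : V) :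
    (expect D fun z => ‖ω - η • lsGrad a y ω z - w‖ ^ 2) ≤
      (1 - η * μ) * ‖ω - w‖ ^ 2 + η * σ ^ 2 / 2 := by
  set q := expect D fun z => inner ℝ (a z) (ω - w) ^ 2
  have expand (z : Z) : ‖ω - η • lsGrad a y ω z - w‖ ^ 2 =
      ‖ω - w‖ ^ 2 - (2 * η) * inner ℝ (ω - w) (lsGrad a y ω z) +
        η ^ 2 * ‖lsGrad a y ω z‖ ^ 2 := by
    rw [sub_right_comm, norm_sub_sq_real, inner_smul_right, norm_smul, mul_pow, Real.norm_eq_abs,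
      sq_abs]
    ring
  have expect_eq : (expect D fun z => ‖ω - η • lsGrad a y ω z - w‖ ^ 2) =
      ‖ω - w‖ ^ 2 - 2 * η * q + η ^ 2 * expect D fun z => ‖lsGrad a y ω z‖ ^ 2 := by
    simp only [expand, expect_add, expect_sub, expect_const, expect_mul, expect_inner,
      expect_lsGrad D h.normal_eq, inner_secondMoment_self, q]
  have quadratic_term_le :
      η ^ 2 * (expect D fun z => ‖lsGrad a y ω z‖ ^ 2) ≤ η * (1 / 2 * (q + σ ^ 2)) :=
    calc _ ≤ η ^ 2 * (2 * B ^ 2 * (q + σ ^ 2)) := by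
          gcongr
          exact h.expect_norm_lsGrad_sq_le ω
      _ = η * (2 * (η * B ^ 2) * (q + σ ^ 2)) := by ring
      _ ≤ η * (2 * (1 / 4) * (q + σ ^ 2)) := by
          have : 0 ≤ q := expect_nonneg D fun _ => sq_nonneg _
          gcongr
      _ = η * (1 / 2 * (q + σ ^ 2)) := by ring
  have coercive_step : η * (μ * ‖ω - w‖ ^ 2) ≤ η * q := by
    gcongr
    exact h.coercive _
  have : 0 ≤ η * q := mul_nonneg hη (expect_nonneg D fun _ => sq_nonneg _)
  linarith

theorem coercivity_le [Nontrivial V] : μ ≤ B ^ 2 := by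
  obtain ⟨v, hv⟩ := exists_ne (0 : V)
  exact le_of_mul_le_mul_right ((h.coercive v).trans (expect_inner_sq_le D h.norm_le v))
    (pow_pos (norm_pos_iff.mpr hv) 2)

end IsRegularLeastSquares

/-- A step of averaged stochastic gradient descent for the least squares problem; the state consists
of the iterate `ω_k` and the sum `ω_1 + ⋯ + ω_k`. -/
def lsSGDStep (a : Z → V) (y : Z → ℝ) (η : ℝ) (x : V × V) (z : Z) : V × V :=
  (x.1 - η • lsGrad a y x.1 z, x.2 + (x.1 - η • lsGrad a y x.1 z))

/-- The law of the state of averaged stochastic gradient descent after `k` steps from the origin. -/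
def lsSGD (D : PMF Z) (a : Z → V) (y : Z → ℝ) (η : ℝ) : ℕ → PMF (V × V)
  | 0 => PMF.pure (0, 0)
  | k + 1 => (lsSGD D a y η k).bind fun x => D.map (lsSGDStep a y η x)

instance finite_support_lsSGD (η : ℝ) : ∀ k, Finite (lsSGD D a y η k).support
  | 0 => finite_support_pure _
  | k + 1 => by
    have := finite_support_lsSGD η k
    unfold lsSGD
    infer_instance

theorem expect_lsSGD_succ {W : Type*} [NormedAddCommGroup W] [NormedSpace ℝ W] (η : ℝ) (k : ℕ)
    (f : V × V → W) :
    expect (lsSGD D a y η (k + 1)) f =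
      expect (lsSGD D a y η k) fun x => expect D fun z => f (lsSGDStep a y η x z) := by
  simp only [lsSGD, expect_bind, expect_map]

/-- The martingale `∑_{j < k} (A (ω_j - w) - g_j)` of the deviations of the stochastic gradients
`g_j` from their conditional means, as a function of the state: the `g_j` telescope, because
`ω_k = -η ∑_{j < k} g_j`. -/
def lsMartingale (D : PMF Z) (a : Z → V) (w : V) (η : ℝ) (k : ℕ) (x : V × V) : V :=
  secondMoment D a (x.2 - (k : ℝ) • w - x.1) + η⁻¹ • x.1

omit [Finite D.support] in
theorem lsMartingale_step (w : V) {η : ℝ} (hη : η ≠ 0) (k : ℕ) (x : V × V) (z : Z) :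
    lsMartingale D a w η (k + 1) (lsSGDStep a y η x z) =
      lsMartingale D a w η k x + (secondMoment D a (x.1 - w) - lsGrad a y x.1 z) := by
  have total_step : (lsSGDStep a y η x z).2 - ((k + 1 : ℕ) : ℝ) • w - (lsSGDStep a y η x z).1 =
      (x.2 - (k : ℝ) • w - x.1) + (x.1 - w) := by
    simp only [lsSGDStep]
    push_cast
    module
  rw [lsMartingale, lsMartingale, total_step, map_add, lsSGDStep, smul_sub, smul_smul,
    inv_mul_cancel₀ hη, one_smul]
  abel

theorem sq_mul_norm_average_sub_le {B μ η : ℝ} (norm_le : ∀ z, ‖a z‖ ≤ B)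
    (coercive : ∀ v, μ * ‖v‖ ^ 2 ≤ expect D fun z => inner ℝ (a z) v ^ 2) (hμ : 0 ≤ μ)
    (hη : 0 < η) (hηB : η * B ^ 2 ≤ 1 / 4) (w : V) {k : ℕ} (hk : k ≠ 0) (x : V × V) :
    (k * μ) ^ 2 * ‖(1 / k : ℝ) • x.2 - w‖ ^ 2 ≤
      2 * ‖lsMartingale D a w η k x‖ ^ 2 + 16 / η ^ 2 * (‖x.1 - w‖ ^ 2 + ‖w‖ ^ 2) := by
  set u := x.2 - (k : ℝ) • w with hu
  have average_sub : (k : ℝ) • ((1 / k : ℝ) • x.2 - w) = u := by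
    rw [smul_sub, smul_smul, mul_one_div_cancel (Nat.cast_ne_zero.mpr hk), one_smul]
  have secondMoment_u :
      secondMoment D a u = lsMartingale D a w η k x + (secondMoment D a x.1 - η⁻¹ • x.1) := by
    rw [lsMartingale, ← hu, map_sub _ u]
    abel
  have norm_remainder_le : ‖secondMoment D a x.1 - η⁻¹ • x.1‖ ≤ 2 / η * ‖x.1‖ :=
    calc _ ≤ B ^ 2 * ‖x.1‖ + η⁻¹ * ‖x.1‖ := by
          refine (norm_sub_le _ _).trans ?_
          rw [norm_smul, Real.norm_of_nonneg (inv_nonneg.mpr hη.le)]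
          gcongr
          exact norm_secondMoment_apply_le D norm_le _
      _ = (η * B ^ 2 + 1) / η * ‖x.1‖ := by field_simp
      _ ≤ 2 / η * ‖x.1‖ := by gcongr; linarith
  have norm_iterate_sq_le : ‖x.1‖ ^ 2 ≤ 2 * ‖x.1 - w‖ ^ 2 + 2 * ‖w‖ ^ 2 := by
    simpa only [sub_add_cancel] using norm_add_sq_le (x.1 - w) w
  calc (k * μ) ^ 2 * ‖(1 / k : ℝ) • x.2 - w‖ ^ 2 = (μ * ‖u‖) ^ 2 := by
        rw [← average_sub, norm_smul, Real.norm_natCast]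
        ring
    _ ≤ ‖secondMoment D a u‖ ^ 2 := by
        gcongr
        exact le_norm_secondMoment_apply D coercive u
    _ ≤ 2 * ‖lsMartingale D a w η k x‖ ^ 2 + 2 * (2 / η * ‖x.1‖) ^ 2 := by
        rw [secondMoment_u]
        refine (norm_add_sq_le _ _).trans ?_
        gcongr
    _ = 2 * ‖lsMartingale D a w η k x‖ ^ 2 + 8 / η ^ 2 * ‖x.1‖ ^ 2 := by ring
    _ ≤ 2 * ‖lsMartingale D a w η k x‖ ^ 2 +
          8 / η ^ 2 * (2 * ‖x.1 - w‖ ^ 2 + 2 * ‖w‖ ^ 2) := by gcongr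
    _ = _ := by ring

namespace IsRegularLeastSquares

variable {D} {w : V} {B μ σ η : ℝ} (h : IsRegularLeastSquares D a y w B μ σ)

include h

theorem expect_norm_iterate_sub_sq_le (hμ : 0 < μ) (hη : 0 ≤ η) (hηB : η * B ^ 2 ≤ 1 / 4) (k : ℕ) :
    (expect (lsSGD D a y η k) fun x => ‖x.1 - w‖ ^ 2) ≤ ‖w‖ ^ 2 + σ ^ 2 / (2 * μ) := by
  rcases subsingleton_or_nontrivial V with _ | _
  · refine expect_le_const _ fun x => ?_
    rw [Subsingleton.elim (x.1 - w) w]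
    exact le_add_of_nonneg_right (by positivity)
  induction k with
  | zero =>
    rw [lsSGD, expect_pure, zero_sub, norm_neg]
    exact le_add_of_nonneg_right (by positivity)
  | succ k ih =>
    have contraction : 0 ≤ 1 - η * μ := by nlinarith [h.coercivity_le]
    calc (expect (lsSGD D a y η (k + 1)) fun x => ‖x.1 - w‖ ^ 2)
        ≤ (1 - η * μ) * (expect (lsSGD D a y η k) fun x => ‖x.1 - w‖ ^ 2) + η * σ ^ 2 / 2 := by
          rw [expect_lsSGD_succ, ← expect_mul, ← expect_const (lsSGD D a y η k) (η * σ ^ 2 / 2),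
            ← expect_add]
          exact expect_mono _ fun x => by
            simpa only [expect_const, lsSGDStep] using h.expect_norm_step_sub_sq_le hη hηB x.1
      _ ≤ (1 - η * μ) * (‖w‖ ^ 2 + σ ^ 2 / (2 * μ)) + η * σ ^ 2 / 2 := by gcongr
      _ = ‖w‖ ^ 2 + σ ^ 2 / (2 * μ) - η * μ * ‖w‖ ^ 2 := by
          field_simp
          ring
      _ ≤ ‖w‖ ^ 2 + σ ^ 2 / (2 * μ) := sub_le_self _ (by positivity)

theorem expect_norm_lsMartingale_sq_le (hη : η ≠ 0) {G : ℝ}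
    (hG : ∀ k, (expect (lsSGD D a y η k) fun x => expect D fun z => ‖lsGrad a y x.1 z‖ ^ 2) ≤ G)
    (k : ℕ) : (expect (lsSGD D a y η k) fun x => ‖lsMartingale D a w η k x‖ ^ 2) ≤ k * G := by
  induction k with
  | zero => simp [lsSGD, expect_pure, lsMartingale]
  | succ k ih =>
    have step (x : V × V) :
        (expect D fun z => ‖lsMartingale D a w η (k + 1) (lsSGDStep a y η x z)‖ ^ 2) ≤
          ‖lsMartingale D a w η k x‖ ^ 2 + expect D fun z => ‖lsGrad a y x.1 z‖ ^ 2 := by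
      have noise_centered :
          (expect D fun z => expect D (lsGrad a y x.1) - lsGrad a y x.1 z) = 0 := by
        rw [expect_sub, expect_const]
        exact sub_self _
      simp only [lsMartingale_step D w hη, ← expect_lsGrad D h.normal_eq]
      rw [expect_norm_add_sq D _ noise_centered]
      simp only [norm_sub_rev (expect D (lsGrad a y x.1))]
      gcongr
      exact expect_norm_sub_expect_sq_le D _
    calc _ ≤ (expect (lsSGD D a y η k) fun x => ‖lsMartingale D a w η k x‖ ^ 2) +
          expect (lsSGD D a y η k) fun x => expect D fun z => ‖lsGrad a y x.1 z‖ ^ 2 := by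
          rw [expect_lsSGD_succ, ← expect_add]
          exact expect_mono _ step
      _ ≤ k * G + G := add_le_add ih (hG k)
      _ = (k + 1 : ℕ) * G := by push_cast; ring

theorem expect_norm_lsGrad_iterate_sq_le {Q : ℝ} {k : ℕ}
    (hQ : (expect (lsSGD D a y η k) fun x => ‖x.1 - w‖ ^ 2) ≤ Q) :
    (expect (lsSGD D a y η k) fun x => expect D fun z => ‖lsGrad a y x.1 z‖ ^ 2) ≤
      2 * B ^ 2 * (B ^ 2 * Q + σ ^ 2) :=
  calc _ ≤ expect (lsSGD D a y η k) fun x => 2 * B ^ 2 * (B ^ 2 * ‖x.1 - w‖ ^ 2 + σ ^ 2) := by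
        refine expect_mono _ fun x => (h.expect_norm_lsGrad_sq_le x.1).trans ?_
        gcongr
        exact expect_inner_sq_le D h.norm_le _
    _ = 2 * B ^ 2 * (B ^ 2 * (expect (lsSGD D a y η k) fun x => ‖x.1 - w‖ ^ 2) + σ ^ 2) := by
        rw [expect_mul, expect_add, expect_mul, expect_const]
    _ ≤ 2 * B ^ 2 * (B ^ 2 * Q + σ ^ 2) := by gcongr

theorem expect_norm_average_sub_sq_le (hμ : 0 < μ) (hη : 0 < η) (hηB : η * B ^ 2 ≤ 1 / 4) {Q : ℝ}
    (hQ : ‖w‖ ^ 2 + σ ^ 2 / (2 * μ) ≤ Q) {K : ℕ} (hK : K ≠ 0) :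
    (expect (lsSGD D a y η K) fun x => ‖(1 / K : ℝ) • x.2 - w‖ ^ 2) ≤
      (4 * B ^ 2 * (B ^ 2 * Q + σ ^ 2) + 32 * Q / η ^ 2) / μ ^ 2 / K := by
  have iterate_le (k : ℕ) : (expect (lsSGD D a y η k) fun x => ‖x.1 - w‖ ^ 2) ≤ Q :=
    (h.expect_norm_iterate_sub_sq_le hμ hη.le hηB k).trans hQ
  have norm_w_sq_le : ‖w‖ ^ 2 ≤ Q := (le_add_of_nonneg_right (by positivity)).trans hQ
  have : 0 ≤ Q := (sq_nonneg _).trans norm_w_sq_le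
  have hK' : (1 : ℝ) ≤ K := Nat.one_le_cast.mpr (Nat.one_le_iff_ne_zero.mpr hK)
  have scaled_le : (K * μ) ^ 2 * (expect (lsSGD D a y η K) fun x => ‖(1 / K : ℝ) • x.2 - w‖ ^ 2) ≤
      K * (4 * B ^ 2 * (B ^ 2 * Q + σ ^ 2) + 32 * Q / η ^ 2) :=
    calc _ ≤ 2 * (expect (lsSGD D a y η K) fun x => ‖lsMartingale D a w η K x‖ ^ 2) +
          16 / η ^ 2 * ((expect (lsSGD D a y η K) fun x => ‖x.1 - w‖ ^ 2) + ‖w‖ ^ 2) := by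
          rw [← expect_const (lsSGD D a y η K) (‖w‖ ^ 2), ← expect_add, ← expect_mul, ← expect_mul,
            ← expect_mul, ← expect_add]
          exact expect_mono _ fun x => by
            simpa only [expect_const] using
              sq_mul_norm_average_sub_le D h.norm_le h.coercive hμ.le hη hηB w hK x
      _ ≤ 2 * (K * (2 * B ^ 2 * (B ^ 2 * Q + σ ^ 2))) + 16 / η ^ 2 * (Q + Q) := by
          gcongr
          · exact h.expect_norm_lsMartingale_sq_le hη.ne'
              (fun k => h.expect_norm_lsGrad_iterate_sq_le (iterate_le k)) K
          · exact iterate_le K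
      _ = K * (4 * B ^ 2 * (B ^ 2 * Q + σ ^ 2)) + 32 * Q / η ^ 2 := by ring
      _ ≤ K * (4 * B ^ 2 * (B ^ 2 * Q + σ ^ 2)) + K * (32 * Q / η ^ 2) := by
          gcongr
          exact le_mul_of_one_le_left (by positivity) hK'
      _ = _ := by ring
  rw [div_div, le_div_iff₀ (by positivity)]
  refine le_of_mul_le_mul_left (le_trans (le_of_eq ?_) scaled_le) (zero_lt_one.trans_le hK')
  ring

end IsRegularLeastSquares

end LeastSquares

section Moments

/-- The moment `∑_t γ^t (t+1)^k` of the geometric weights `γ^t`. -/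
def momentSum (γ : ℝ) (k : ℕ) : ℝ := ∑' t : ℕ, γ ^ t * ((t : ℝ) + 1) ^ k

variable {γ : ℝ} (hγ : γ ∈ Set.Ioo 0 1)

include hγ

theorem summable_momentSum (k : ℕ) : Summable fun t : ℕ => γ ^ t * ((t : ℝ) + 1) ^ k := by
  have shifted := (summable_nat_add_iff 1).mpr <|
    summable_pow_mul_geometric_of_norm_lt_one (R := ℝ) k (r := γ)
      (by rw [Real.norm_of_nonneg hγ.1.le]; exact hγ.2)
  refine (shifted.mul_left γ⁻¹).congr fun t => ?_
  have := hγ.1.ne'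
  push_cast
  rw [pow_succ]
  field_simp

theorem momentSum_nonneg (k : ℕ) : 0 ≤ momentSum γ k :=
  tsum_nonneg fun t => mul_nonneg (pow_nonneg hγ.1.le t) (by positivity)

theorem sum_range_le_momentSum (k H : ℕ) :
    ∑ t ∈ Finset.range H, γ ^ t * ((t : ℝ) + 1) ^ k ≤ momentSum γ k :=
  (summable_momentSum hγ k).sum_le_tsum _ fun t _ =>
    mul_nonneg (pow_nonneg hγ.1.le t) (by positivity)

theorem sum_range_pow_le_inv_one_sub (H : ℕ) : ∑ t ∈ Finset.range H, γ ^ t ≤ (1 - γ)⁻¹ := by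
  rw [← tsum_geometric_of_lt_one hγ.1.le hγ.2]
  exact (summable_geometric_of_lt_one hγ.1.le hγ.2).sum_le_tsum _ fun t _ => pow_nonneg hγ.1.le t

theorem sqrt_mem_Ioo : √γ ∈ Set.Ioo 0 1 :=
  ⟨Real.sqrt_pos.mpr hγ.1, by rw [Real.sqrt_lt' one_pos, one_pow]; exact hγ.2⟩

theorem sqrt_pow_sq (n : ℕ) : (√γ ^ n) ^ 2 = γ ^ n := by
  rw [pow_right_comm, Real.sq_sqrt hγ.1.le]

-- Half of the exponent pays for the factor `√γ ^ H`, the other half for summability.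
theorem norm_tsum_sub_sum_range_le {V : Type*} [NormedAddCommGroup V] [CompleteSpace V]
    {f : ℕ → V} {c : ℝ} (hf : ∀ t, ‖f t‖ ≤ c * (γ ^ t * ((t : ℝ) + 1))) (H : ℕ) :
    ‖∑' t, f t - ∑ t ∈ Finset.range H, f t‖ ≤ c * (√γ ^ H * momentSum √γ 1) := by
  obtain ⟨sqrt_pos, sqrt_lt_one⟩ := sqrt_mem_Ioo hγ
  have c_nonneg : 0 ≤ c := by simpa using (norm_nonneg _).trans (hf 0)
  have summable : Summable f :=
    .of_norm_bounded ((summable_momentSum hγ 1).mul_left c) fun t => by simpa using hf t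
  have moments := summable_momentSum (sqrt_mem_Ioo hγ) 1
  have pow_le (t : ℕ) : γ ^ (t + H) ≤ √γ ^ H * √γ ^ (t + H) := by
    rw [← sqrt_pow_sq hγ, sq]
    gcongr ?_ * _
    exact pow_le_pow_of_le_one sqrt_pos.le sqrt_lt_one.le (Nat.le_add_left H t)
  have term_le (t : ℕ) : ‖f (t + H)‖ ≤
      (c * √γ ^ H) * (√γ ^ (t + H) * (((t + H : ℕ) : ℝ) + 1) ^ 1) :=
    calc ‖f (t + H)‖ ≤ c * ((√γ ^ H * √γ ^ (t + H)) * (((t + H : ℕ) : ℝ) + 1)) :=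
          (hf (t + H)).trans (by gcongr; exact pow_le t)
      _ = _ := by ring
  rw [← summable.sum_add_tsum_nat_add H, add_sub_cancel_left]
  calc ‖∑' t, f (t + H)‖
      ≤ (c * √γ ^ H) * ∑' t : ℕ, √γ ^ (t + H) * (((t + H : ℕ) : ℝ) + 1) ^ 1 := by
        rw [← tsum_mul_left]
        exact tsum_of_norm_bounded
          (((summable_nat_add_iff H).mpr moments).mul_left (c * √γ ^ H)).hasSum term_le
    _ ≤ (c * √γ ^ H) * momentSum √γ 1 := by
        gcongr
        rw [momentSum, ← moments.sum_add_tsum_nat_add H]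
        exact le_add_of_nonneg_left (Finset.sum_nonneg fun i _ => by positivity)
    _ = c * (√γ ^ H * momentSum √γ 1) := mul_assoc _ _ _

end Moments

section Score

variable {X Θ V : Type*} [NormedAddCommGroup Θ] [InnerProductSpace ℝ Θ]
  [NormedAddCommGroup V] [NormedSpace ℝ V]

/-- `sc` is the score (the gradient of the log-likelihood) of the family `p` of laws. The condition
is stated as `∇ p = p • sc`, which needs no positivity of the probabilities. -/
def IsScore (p : Θ → PMF X) (sc : Θ → X → Θ) : Prop :=
  ∀ θ x, HasFDerivAt (fun θ' => (p θ' x).toReal) (innerSL ℝ ((p θ x).toReal • sc θ x)) θ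

namespace IsScore

variable [Finite X] {p : Θ → PMF X} {sc : Θ → X → Θ} (h : IsScore p sc)

include h

theorem hasFDerivAt_expect (f : X → V) (θ : Θ) :
    HasFDerivAt (fun θ' => expect (p θ') f)
      (expect (p θ) fun x => (innerSL ℝ (sc θ x)).smulRight (f x)) θ := by
  have := Fintype.ofFinite X
  simp only [expect_eq_sum]
  refine HasFDerivAt.fun_sum fun x _ => ((h θ x).smul_const (f x)).congr_fderiv ?_
  ext v
  simp [mul_smul]

theorem hasFDerivAt_expect_real (f : X → ℝ) (θ : Θ) :
    HasFDerivAt (fun θ' => expect (p θ') f)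
      (innerSL ℝ (expect (p θ) fun x => f x • sc θ x)) θ := by
  have := Fintype.ofFinite X
  refine (h.hasFDerivAt_expect f θ).congr_fderiv ?_
  simp only [expect_eq_sum, map_sum]
  refine Finset.sum_congr rfl fun x _ => ?_
  ext v
  simp [mul_comm]

variable {b : ℝ} (norm_score_le : ∀ θ x, ‖sc θ x‖ ≤ b)

include norm_score_le

theorem norm_expect_sub_le {f : X → V} {c : ℝ} (hf : ∀ x, ‖f x‖ ≤ c) (θ θ' : Θ) :
    ‖expect (p θ) f - expect (p θ') f‖ ≤ c * b * ‖θ - θ'‖ := by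
  refine convex_univ.norm_image_sub_le_of_norm_hasFDerivWithin_le
    (fun θ _ => (h.hasFDerivAt_expect f θ).hasFDerivWithinAt)
    (fun θ _ => norm_expect_le_const _ fun x => ?_) (Set.mem_univ θ') (Set.mem_univ θ)
  rw [ContinuousLinearMap.norm_smulRight_apply, innerSL_apply_norm, mul_comm]
  exact mul_le_mul (hf x) (norm_score_le θ x) (norm_nonneg _) ((norm_nonneg _).trans (hf x))

theorem norm_expect_smul_sub_le {l : ℝ}
    (norm_score_sub_le : ∀ θ θ' x, ‖sc θ x - sc θ' x‖ ≤ l * ‖θ - θ'‖) {f : X → ℝ} {c : ℝ}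
    (hf : ∀ x, ‖f x‖ ≤ c) (θ θ' : Θ) :
    ‖(expect (p θ) fun x => f x • sc θ x) - expect (p θ') fun x => f x • sc θ' x‖ ≤
      c * (b ^ 2 + l) * ‖θ - θ'‖ := by
  have norm_smul_le (x : X) {v : Θ} {r : ℝ} (hv : ‖v‖ ≤ r) : ‖f x • v‖ ≤ c * r := by
    rw [norm_smul]
    exact mul_le_mul (hf x) hv (norm_nonneg _) ((norm_nonneg _).trans (hf x))
  calc _ ≤ ‖(expect (p θ) fun x => f x • sc θ x) - expect (p θ') fun x => f x • sc θ x‖ +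
        ‖expect (p θ') fun x => f x • sc θ x - f x • sc θ' x‖ := by
        rw [expect_sub]
        exact norm_sub_le_norm_sub_add_norm_sub _ _ _
    _ ≤ c * b * b * ‖θ - θ'‖ + c * (l * ‖θ - θ'‖) := by
        refine add_le_add
          (h.norm_expect_sub_le norm_score_le (fun x => norm_smul_le x (norm_score_le θ x)) θ θ')
          (norm_expect_le_const _ fun x => ?_)
        rw [← smul_sub]
        exact norm_smul_le x (norm_score_sub_le θ θ' x)
    _ = c * (b ^ 2 + l) * ‖θ - θ'‖ := by ring

end IsScore

end Score

section Softmax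

variable {A : Type*} [Fintype A] [Nonempty A]

theorem sum_exp_pos (v : A → ℝ) : 0 < ∑ a, Real.exp (v a) :=
  Finset.sum_pos (fun _ _ => Real.exp_pos _) Finset.univ_nonempty

theorem softmaxProb_pos (v : A → ℝ) (a : A) : 0 < softmaxProb v a :=
  div_pos (Real.exp_pos _) (sum_exp_pos v)

theorem softmax_toReal (v : A → ℝ) (a : A) : (softmax v a).toReal = softmaxProb v a := by
  simp [softmax, (softmaxProb_pos v a).le]

theorem log_softmaxProb (v : A → ℝ) (a : A) :
    Real.log (softmaxProb v a) = v a - Real.log (∑ b, Real.exp (v b)) := by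
  rw [softmaxProb, Real.log_div (Real.exp_ne_zero _) (sum_exp_pos v).ne', Real.log_exp]

end Softmax

namespace Problem.PolicyRegular

variable {S A : Type*} [Fintype S] [Fintype A] {d m : ℕ} {M : Problem S A d m} {lψ Lψ : ℝ}
  (h : M.PolicyRegular lψ Lψ)

include h

theorem hasFDerivAt (s : S) (a : A) (θ : E d) :
    HasFDerivAt (M.ψ s a) (innerSL ℝ (gradient (M.ψ s a) θ)) θ :=
  ((h.contDiff s a).differentiable two_ne_zero θ).hasGradientAt.hasFDerivAt

theorem norm_gradient_sub_le (s : S) (a : A) (θ θ' : E d) :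
    ‖gradient (M.ψ s a) θ - gradient (M.ψ s a) θ'‖ ≤ Lψ * ‖θ - θ'‖ := by
  have contDiff_fderiv : ContDiff ℝ 1 (fderiv ℝ (M.ψ s a)) :=
    (h.contDiff s a).fderiv_right (by norm_num)
  have differentiable_gradient : Differentiable ℝ (gradient (M.ψ s a)) :=
    (InnerProductSpace.toDual ℝ (E d)).symm.differentiable.comp
      (contDiff_fderiv.differentiable one_ne_zero)
  exact convex_univ.norm_image_sub_le_of_norm_fderiv_le (fun θ _ => differentiable_gradient θ)
    (fun θ _ => h.hess_le s a θ) (Set.mem_univ θ') (Set.mem_univ θ)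

variable [Nonempty A]

theorem gradBound_nonneg : 0 ≤ lψ := by
  obtain ⟨s, _⟩ := M.ρ.support_nonempty
  obtain ⟨a⟩ := ‹Nonempty A›
  exact (norm_nonneg _).trans (h.grad_le s a 0)

theorem hessBound_nonneg : 0 ≤ Lψ := by
  obtain ⟨s, _⟩ := M.ρ.support_nonempty
  obtain ⟨a⟩ := ‹Nonempty A›
  exact (norm_nonneg _).trans (h.hess_le s a 0)

theorem hasFDerivAt_log_softmaxProb (s : S) (a : A) (θ : E d) :
    HasFDerivAt (fun θ' => Real.log (softmaxProb (fun a' => M.ψ s a' θ') a))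
      (innerSL ℝ
        (gradient (M.ψ s a) θ - expect (M.policy θ s) fun b => gradient (M.ψ s b) θ)) θ := by
  simp only [log_softmaxProb, map_sub]
  refine (h.hasFDerivAt s a θ).sub ?_
  have hasFDerivAt_sum_exp : HasFDerivAt (fun θ' => ∑ b, Real.exp (M.ψ s b θ'))
      (∑ b, Real.exp (M.ψ s b θ) • innerSL ℝ (gradient (M.ψ s b) θ)) θ :=
    HasFDerivAt.fun_sum fun b _ => (h.hasFDerivAt s b θ).exp
  refine (hasFDerivAt_sum_exp.log (sum_exp_pos fun b => M.ψ s b θ).ne').congr_fderiv ?_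
  rw [expect_eq_sum, map_sum, Finset.smul_sum]
  refine Finset.sum_congr rfl fun b _ => ?_
  rw [map_smul, policy, softmax_toReal, softmaxProb, smul_smul, div_eq_inv_mul]

theorem score_eq (s : S) (a : A) (θ : E d) :
    M.score θ s a =
      gradient (M.ψ s a) θ - expect (M.policy θ s) fun b => gradient (M.ψ s b) θ :=
  HasGradientAt.gradient (h.hasFDerivAt_log_softmaxProb s a θ)

theorem isScore_policy (s : S) : IsScore (fun θ => M.policy θ s) fun θ a => M.score θ s a := by
  intro θ a
  have := (h.hasFDerivAt_log_softmaxProb s a θ).exp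
  simp only [← h.score_eq, Real.exp_log (softmaxProb_pos _ _)] at this
  simpa only [policy, softmax_toReal, map_smul] using this

theorem norm_score_le (θ : E d) (s : S) (a : A) : ‖M.score θ s a‖ ≤ 2 * lψ := by
  rw [h.score_eq, two_mul]
  exact (norm_sub_le _ _).trans
    (add_le_add (h.grad_le s a θ) (norm_expect_le_const _ fun b => h.grad_le s b θ))

theorem norm_score_sub_le (s : S) (a : A) (θ θ' : E d) :
    ‖M.score θ s a - M.score θ' s a‖ ≤ (2 * Lψ + 2 * lψ ^ 2) * ‖θ - θ'‖ := by
  have mean_grad_sub_le : ‖expect (M.policy θ s) fun b =>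
      gradient (M.ψ s b) θ - gradient (M.ψ s b) θ'‖ ≤ Lψ * ‖θ - θ'‖ :=
    norm_expect_le_const _ fun b => h.norm_gradient_sub_le s b θ θ'
  have mean_policy_sub_le := (h.isScore_policy s).norm_expect_sub_le
    (fun θ a => h.norm_score_le θ s a) (fun b => h.grad_le s b θ') θ θ'
  set mean := expect (M.policy θ s) fun b => gradient (M.ψ s b) θ'
  set mean' := expect (M.policy θ' s) fun b => gradient (M.ψ s b) θ'
  have split : M.score θ s a - M.score θ' s a =
      (gradient (M.ψ s a) θ - gradient (M.ψ s a) θ') -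
        (expect (M.policy θ s) fun b => gradient (M.ψ s b) θ - gradient (M.ψ s b) θ') -
        (mean - mean') := by
    rw [h.score_eq, h.score_eq, expect_sub]
    abel
  calc ‖M.score θ s a - M.score θ' s a‖
      ≤ Lψ * ‖θ - θ'‖ + Lψ * ‖θ - θ'‖ + lψ * (2 * lψ) * ‖θ - θ'‖ := by
        rw [split]
        exact (norm_sub_le _ _).trans (add_le_add ((norm_sub_le _ _).trans
          (add_le_add (h.norm_gradient_sub_le s a θ θ') mean_grad_sub_le)) mean_policy_sub_le)
    _ = (2 * Lψ + 2 * lψ ^ 2) * ‖θ - θ'‖ := by ring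

end Problem.PolicyRegular

theorem exists_norm_le_one_and_sum_abs_eq {ι : Type*} [Fintype ι] (x : ι → ℝ) :
    ∃ u : ι → ℝ, ‖u‖ ≤ 1 ∧ ∑ i, |x i| = ∑ i, u i * x i := by
  refine ⟨fun i => SignType.sign (x i), (pi_norm_le_iff_of_nonneg zero_le_one).mpr fun i => ?_,
    Finset.sum_congr rfl fun i _ => by rw [sign_mul_self]⟩
  rcases lt_trichotomy (x i) 0 with neg | zero | pos <;> simp [*]

theorem bind_apply_eq_mul {X Y : Type*} (p : PMF X) {q : X → PMF Y} {x : X} {y : Y}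
    (h : ∀ x' ≠ x, q x' y = 0) : p.bind q y = p x * q x y := by
  rw [PMF.bind_apply, tsum_eq_single x fun x' hx' => by rw [h x' hx', mul_zero]]

/-- A bound on the gradient of `θ ↦ ⟨u, λ(θ)⟩` for `‖u‖_∞ ≤ 1`. -/
def occGradBound (γ lψ : ℝ) : ℝ := 2 * lψ * momentSum γ 1

/-- A Lipschitz constant of the gradient of `θ ↦ ⟨u, λ(θ)⟩` for `‖u‖_∞ ≤ 1`. -/
def occHessBound (γ lψ Lψ : ℝ) : ℝ := (6 * lψ ^ 2 + 2 * Lψ) * momentSum γ 2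

namespace Problem

variable {S A : Type*} [Fintype S] [Fintype A] {d m : ℕ} {M : Problem S A d m}

section Trajectories

variable {V : Type*} [NormedAddCommGroup V] [NormedSpace ℝ V]

theorem expect_trajLaw_succ (π : S → PMF A) (n : ℕ) (f : (Fin (n + 1) → S × A) → V) :
    expect (M.trajLaw π (n + 1)) f = expect (M.trajLaw π n) fun τ =>
      expect (M.nextState τ) fun s => expect (π s) fun a => f (Fin.snoc τ (s, a)) := by
  simp only [trajLaw, expect_bind, expect_pure]

theorem expect_trajLaw_init (π : S → PMF A) (n : ℕ) (f : (Fin n → S × A) → V) :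
    (expect (M.trajLaw π (n + 1)) fun τ => f (Fin.init τ)) = expect (M.trajLaw π n) f := by
  simp only [expect_trajLaw_succ, Fin.init_snoc, expect_const]

theorem expect_pairLaw (π : S → PMF A) (t : ℕ) (u : S × A → V) :
    expect (M.pairLaw π t) u = expect (M.trajLaw π (t + 1)) fun τ => u (τ (Fin.last t)) :=
  expect_map _ _ _

theorem expect_trajLaw_sum (π : S → PMF A) (H : ℕ) (u : S × A → ℝ) :
    (expect (M.trajLaw π H) fun τ => ∑ h : Fin H, M.γ ^ (h : ℕ) * u (τ h)) =
      ∑ t ∈ Finset.range H, M.γ ^ t * expect (M.pairLaw π t) u := by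
  induction H with
  | zero => simp [trajLaw, expect_pure]
  | succ H ih =>
    simp only [Fin.sum_univ_castSucc, expect_add, Finset.sum_range_succ, expect_mul,
      Fin.val_castSucc, Fin.val_last]
    rw [← ih, expect_pairLaw,
      ← expect_trajLaw_init π H fun τ => ∑ h : Fin H, M.γ ^ (h : ℕ) * u (τ h)]
    rfl

theorem trajLaw_snoc_apply (π : S → PMF A) {n : ℕ} (τ : Fin n → S × A) (s : S) (a : A) :
    M.trajLaw π (n + 1) (Fin.snoc (α := fun _ => S × A) τ (s, a)) =
      M.trajLaw π n τ * (M.nextState τ s * π s a) := by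
  classical
  have snoc_ne {τ' : Fin n → S × A} {s' : S} {a' : A} (ne : ¬(τ = τ' ∧ s = s' ∧ a = a')) :
      PMF.pure (Fin.snoc (α := fun _ => S × A) τ' (s', a'))
        (Fin.snoc (α := fun _ => S × A) τ (s, a)) = 0 := by
    rw [PMF.pure_apply, if_neg]
    rwa [Fin.snoc_inj, Prod.mk.injEq]
  rw [trajLaw, bind_apply_eq_mul (x := τ), bind_apply_eq_mul (x := s),
    bind_apply_eq_mul (x := a), PMF.pure_apply, if_pos rfl, mul_one]
  · exact fun a' ne => snoc_ne (by tauto)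
  · exact fun s' ne => by
      simp only [PMF.bind_apply, snoc_ne fun eq => ne eq.2.1.symm, mul_zero, tsum_zero]
  · exact fun τ' ne => by
      simp only [PMF.bind_apply, snoc_ne fun eq => ne eq.1.symm, mul_zero, tsum_zero]

end Trajectories

section Occupancy

theorem sum_mul_occTrunc (π : S → PMF A) (H : ℕ) (u : S × A → ℝ) :
    ∑ p, u p * M.occTrunc H π p = ∑ t ∈ Finset.range H, M.γ ^ t * expect (M.pairLaw π t) u := by
  simp only [occTrunc, expect_eq_sum, Finset.mul_sum, smul_eq_mul]
  rw [Finset.sum_comm]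
  exact Finset.sum_congr rfl fun t _ => Finset.sum_congr rfl fun p _ => by ring

variable (hγ : M.γ ∈ Set.Ioo 0 1)

include hγ

theorem norm_pow_mul_expect_pairLaw_le (π : S → PMF A) (u : S × A → ℝ) (t : ℕ) :
    ‖M.γ ^ t * expect (M.pairLaw π t) u‖ ≤ ‖u‖ * (M.γ ^ t * ((t : ℝ) + 1)) := by
  have pow_nonneg := pow_nonneg hγ.1.le t
  calc ‖M.γ ^ t * expect (M.pairLaw π t) u‖ ≤ M.γ ^ t * ‖u‖ := by
        rw [norm_mul, Real.norm_of_nonneg pow_nonneg]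
        gcongr
        exact norm_expect_le_const _ (norm_le_pi_norm u)
    _ ≤ M.γ ^ t * ‖u‖ * (t + 1) :=
        le_mul_of_one_le_right (by positivity) (le_add_of_nonneg_left t.cast_nonneg)
    _ = ‖u‖ * (M.γ ^ t * (t + 1)) := by ring

theorem summable_pow_mul_toReal_pairLaw (π : S → PMF A) (p : S × A) :
    Summable fun t => M.γ ^ t * (M.pairLaw π t p).toReal :=
  (summable_geometric_of_lt_one hγ.1.le hγ.2).of_nonneg_of_le
    (fun t => mul_nonneg (pow_nonneg hγ.1.le t) ENNReal.toReal_nonneg)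
    fun t => mul_le_of_le_one_right (pow_nonneg hγ.1.le t)
      (ENNReal.toReal_mono ENNReal.one_ne_top (PMF.coe_le_one _ p))

theorem hasSum_sum_mul_occ (π : S → PMF A) (u : S × A → ℝ) :
    HasSum (fun t => M.γ ^ t * expect (M.pairLaw π t) u) (∑ p, u p * M.occ π p) := by
  refine (hasSum_sum fun p _ =>
    (summable_pow_mul_toReal_pairLaw hγ π p).hasSum.mul_left (u p)).congr_fun fun t => ?_
  rw [expect_eq_sum, Finset.mul_sum]
  exact Finset.sum_congr rfl fun p _ => by rw [smul_eq_mul]; ring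

theorem sum_abs_occ_sub_occTrunc_le (π : S → PMF A) (H : ℕ) :
    ∑ p, |M.occ π p - M.occTrunc H π p| ≤ √M.γ ^ H * momentSum √M.γ 1 := by
  obtain ⟨u, norm_le_one, sum_abs_eq⟩ :=
    exists_norm_le_one_and_sum_abs_eq fun p => M.occ π p - M.occTrunc H π p
  simp only [sum_abs_eq, mul_sub, Finset.sum_sub_distrib, sum_mul_occTrunc,
    ← (hasSum_sum_mul_occ hγ π u).tsum_eq]
  exact (le_abs_self _).trans <|
    (norm_tsum_sub_sum_range_le hγ (norm_pow_mul_expect_pairLaw_le hγ π u) H).trans <|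
      mul_le_of_le_one_left (mul_nonneg (by positivity) (momentSum_nonneg (sqrt_mem_Ioo hγ) 1))
        norm_le_one

end Occupancy

/-- The score of a trajectory: the sum of the scores of its actions. -/
def trajScore (M : Problem S A d m) {n : ℕ} (θ : E d) (τ : Fin n → S × A) : E d :=
  ∑ i, M.score θ (τ i).1 (τ i).2

theorem trajScore_snoc {n : ℕ} (θ : E d) (τ : Fin n → S × A) (s : S) (a : A) :
    M.trajScore θ (Fin.snoc (α := fun _ => S × A) τ (s, a)) = M.trajScore θ τ + M.score θ s a := by
  simp only [trajScore, Fin.sum_univ_castSucc, Fin.snoc_castSucc, Fin.snoc_last]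

variable [Nonempty A]

/-- The gradient of `θ ↦ 𝔼 u(s_t, a_t)`. -/
def pairGrad (M : Problem S A d m) (θ : E d) (t : ℕ) (u : S × A → ℝ) : E d :=
  expect (M.trajLaw (M.policy θ) (t + 1)) fun τ => u (τ (Fin.last t)) • M.trajScore θ τ

/-- The gradient of `θ ↦ ⟨u, λ_H(θ)⟩`. -/
def occGradTrunc (M : Problem S A d m) (H : ℕ) (θ : E d) (u : S × A → ℝ) : E d :=
  ∑ t ∈ Finset.range H, M.γ ^ t • M.pairGrad θ t u

/-- The gradient of `θ ↦ ⟨u, λ(θ)⟩`. -/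
def occGrad (M : Problem S A d m) (θ : E d) (u : S × A → ℝ) : E d :=
  ∑' t, M.γ ^ t • M.pairGrad θ t u

theorem pairGrad_sub (θ : E d) (t : ℕ) (u v : S × A → ℝ) :
    M.pairGrad θ t (u - v) = M.pairGrad θ t u - M.pairGrad θ t v := by
  simp only [pairGrad, Pi.sub_apply, sub_smul, expect_sub]

namespace PolicyRegular

variable {lψ Lψ : ℝ} (h : M.PolicyRegular lψ Lψ)

include h

theorem isScore_traj (n : ℕ) :
    IsScore (fun θ => M.trajLaw (M.policy θ) n) fun θ τ => M.trajScore θ τ := by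
  induction n with
  | zero =>
    intro θ τ
    simp only [trajLaw, trajScore, Finset.univ_eq_empty, Finset.sum_empty, smul_zero, map_zero]
    exact hasFDerivAt_const _ _
  | succ n ih =>
    intro θ τ
    induction τ using Fin.snocCases with | _ τ sa
    obtain ⟨s, a⟩ := sa
    simp only [trajLaw_snoc_apply, trajScore_snoc, ENNReal.toReal_mul]
    refine ((ih θ τ).mul ((h.isScore_policy s θ a).const_mul _)).congr_fderiv ?_
    simp only [map_smul, map_add]
    module

theorem norm_trajScore_le {n : ℕ} (θ : E d) (τ : Fin n → S × A) :
    ‖M.trajScore θ τ‖ ≤ 2 * lψ * n :=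
  (norm_sum_le_of_le _ fun i _ => h.norm_score_le θ (τ i).1 (τ i).2).trans_eq
    (by simp [mul_comm])

theorem norm_trajScore_sub_le {n : ℕ} (θ θ' : E d) (τ : Fin n → S × A) :
    ‖M.trajScore θ τ - M.trajScore θ' τ‖ ≤ (2 * Lψ + 2 * lψ ^ 2) * n * ‖θ - θ'‖ := by
  rw [trajScore, trajScore, ← Finset.sum_sub_distrib]
  refine (norm_sum_le_of_le _ fun i _ =>
    h.norm_score_sub_le (τ i).1 (τ i).2 θ θ').trans_eq ?_
  simp only [Finset.sum_const, Finset.card_univ, Fintype.card_fin, nsmul_eq_mul]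
  ring

theorem hasFDerivAt_expect_pairLaw (θ : E d) (t : ℕ) (u : S × A → ℝ) :
    HasFDerivAt (fun θ' => expect (M.pairLaw (M.policy θ') t) u)
      (innerSL ℝ (M.pairGrad θ t u)) θ := by
  simp only [expect_pairLaw]
  exact (h.isScore_traj (t + 1)).hasFDerivAt_expect_real _ θ

theorem norm_pairGrad_le (θ : E d) (t : ℕ) (u : S × A → ℝ) :
    ‖M.pairGrad θ t u‖ ≤ ‖u‖ * (2 * lψ * ((t : ℝ) + 1)) := by
  refine norm_expect_le_const _ fun τ => ?_
  rw [norm_smul]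
  exact mul_le_mul (norm_le_pi_norm u _) (mod_cast h.norm_trajScore_le θ τ) (norm_nonneg _)
    (norm_nonneg _)

theorem norm_pairGrad_sub_le (θ θ' : E d) (t : ℕ) (u : S × A → ℝ) :
    ‖M.pairGrad θ t u - M.pairGrad θ' t u‖ ≤
      ‖u‖ * ((6 * lψ ^ 2 + 2 * Lψ) * ((t : ℝ) + 1) ^ 2) * ‖θ - θ'‖ := by
  refine ((h.isScore_traj (t + 1)).norm_expect_smul_sub_le h.norm_trajScore_le
    h.norm_trajScore_sub_le (fun τ => norm_le_pi_norm u (τ (Fin.last t))) θ θ').trans ?_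
  have := h.hessBound_nonneg
  have le_sq : ((t : ℝ) + 1) ≤ ((t : ℝ) + 1) ^ 2 :=
    le_self_pow₀ (le_add_of_nonneg_left t.cast_nonneg) two_ne_zero
  push_cast
  gcongr
  calc (2 * lψ * ((t : ℝ) + 1)) ^ 2 + (2 * Lψ + 2 * lψ ^ 2) * ((t : ℝ) + 1)
      ≤ (2 * lψ * ((t : ℝ) + 1)) ^ 2 + (2 * Lψ + 2 * lψ ^ 2) * ((t : ℝ) + 1) ^ 2 := by gcongr
    _ = (6 * lψ ^ 2 + 2 * Lψ) * ((t : ℝ) + 1) ^ 2 := by ring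

variable (hγ : M.γ ∈ Set.Ioo 0 1)

include hγ

theorem norm_pow_smul_pairGrad_le (θ : E d) (u : S × A → ℝ) (t : ℕ) :
    ‖M.γ ^ t • M.pairGrad θ t u‖ ≤ (2 * lψ * ‖u‖) * (M.γ ^ t * ((t : ℝ) + 1)) := by
  have := hγ.1.le
  rw [norm_smul, norm_pow, Real.norm_of_nonneg hγ.1.le]
  calc _ ≤ M.γ ^ t * (‖u‖ * (2 * lψ * ((t : ℝ) + 1))) := by
        gcongr
        exact h.norm_pairGrad_le θ t u
    _ = _ := by ring

theorem summable_pow_smul_pairGrad (θ : E d) (u : S × A → ℝ) :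
    Summable fun t => M.γ ^ t • M.pairGrad θ t u :=
  .of_norm_bounded ((summable_momentSum hγ 1).mul_left (2 * lψ * ‖u‖)) fun t => by
    simpa using h.norm_pow_smul_pairGrad_le hγ θ u t

theorem occGradBound_nonneg : 0 ≤ occGradBound M.γ lψ :=
  mul_nonneg (mul_nonneg zero_le_two h.gradBound_nonneg) (momentSum_nonneg hγ 1)

theorem occHessBound_nonneg : 0 ≤ occHessBound M.γ lψ Lψ := by
  have := h.hessBound_nonneg
  exact mul_nonneg (by positivity) (momentSum_nonneg hγ 2)

theorem norm_occGrad_le (θ : E d) (u : S × A → ℝ) :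
    ‖M.occGrad θ u‖ ≤ occGradBound M.γ lψ * ‖u‖ := by
  refine (tsum_of_norm_bounded ((summable_momentSum hγ 1).mul_left (2 * lψ * ‖u‖)).hasSum
    fun t => by simpa using h.norm_pow_smul_pairGrad_le hγ θ u t).trans_eq ?_
  rw [tsum_mul_left, occGradBound, momentSum]
  ring

theorem occGrad_sub (θ : E d) (u v : S × A → ℝ) :
    M.occGrad θ (u - v) = M.occGrad θ u - M.occGrad θ v := by
  simp only [occGrad, pairGrad_sub, smul_sub]
  exact (h.summable_pow_smul_pairGrad hγ θ u).tsum_sub (h.summable_pow_smul_pairGrad hγ θ v)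

theorem norm_occGrad_sub_arg_le (θ : E d) (u v : S × A → ℝ) :
    ‖M.occGrad θ u - M.occGrad θ v‖ ≤ occGradBound M.γ lψ * ‖u - v‖ := by
  rw [← h.occGrad_sub hγ]
  exact h.norm_occGrad_le hγ θ _

theorem norm_occGrad_sub_le (θ θ' : E d) (u : S × A → ℝ) :
    ‖M.occGrad θ u - M.occGrad θ' u‖ ≤ occHessBound M.γ lψ Lψ * ‖u‖ * ‖θ - θ'‖ := by
  rw [occGrad, occGrad, ← (h.summable_pow_smul_pairGrad hγ θ u).tsum_sub
    (h.summable_pow_smul_pairGrad hγ θ' u)]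
  refine (tsum_of_norm_bounded ((summable_momentSum hγ 2).mul_left
    ((6 * lψ ^ 2 + 2 * Lψ) * ‖u‖ * ‖θ - θ'‖)).hasSum fun t => ?_).trans_eq ?_
  · have := hγ.1.le
    rw [← smul_sub, norm_smul, norm_pow, Real.norm_of_nonneg hγ.1.le]
    calc _ ≤ M.γ ^ t * (‖u‖ * ((6 * lψ ^ 2 + 2 * Lψ) * ((t : ℝ) + 1) ^ 2) * ‖θ - θ'‖) := by
          gcongr
          exact h.norm_pairGrad_sub_le θ θ' t u
      _ = _ := by ring
  · rw [tsum_mul_left, occHessBound, momentSum]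
    ring

theorem norm_occGrad_sub_occGradTrunc_le (θ : E d) (u : S × A → ℝ) (H : ℕ) :
    ‖M.occGrad θ u - M.occGradTrunc H θ u‖ ≤ √M.γ ^ H * (occGradBound √M.γ lψ * ‖u‖) :=
  (norm_tsum_sub_sum_range_le hγ (h.norm_pow_smul_pairGrad_le hγ θ u) H).trans_eq
    (by rw [occGradBound]; ring)

theorem hasFDerivAt_sum_mul_occ (θ : E d) (u : S × A → ℝ) :
    HasFDerivAt (fun θ' => ∑ p, u p * M.occ (M.policy θ') p) (innerSL ℝ (M.occGrad θ u)) θ := by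
  simp only [← (hasSum_sum_mul_occ hγ _ u).tsum_eq]
  rw [occGrad, ContinuousLinearMap.map_tsum _ (h.summable_pow_smul_pairGrad hγ θ u)]
  refine hasFDerivAt_tsum (f := fun t θ' => M.γ ^ t * expect (M.pairLaw (M.policy θ') t) u)
    (f' := fun t θ' => innerSL ℝ (M.γ ^ t • M.pairGrad θ' t u))
    ((summable_momentSum hγ 1).mul_left (2 * lψ * ‖u‖)) (fun t θ' => ?_) (fun t θ' => ?_)
    (hasSum_sum_mul_occ hγ (M.policy θ) u).summable θ
  · rw [map_smul]
    exact (h.hasFDerivAt_expect_pairLaw θ' t u).const_mul _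
  · rw [innerSL_apply_norm, pow_one]
    exact h.norm_pow_smul_pairGrad_le hγ θ' u t

theorem sum_abs_occ_sub_le (θ θ' : E d) :
    ∑ p, |M.occ (M.policy θ) p - M.occ (M.policy θ') p| ≤ occGradBound M.γ lψ * ‖θ - θ'‖ := by
  obtain ⟨u, norm_le_one, sum_abs_eq⟩ := exists_norm_le_one_and_sum_abs_eq
    fun p => M.occ (M.policy θ) p - M.occ (M.policy θ') p
  have norm_grad_le (θ : E d) : ‖innerSL ℝ (M.occGrad θ u)‖ ≤ occGradBound M.γ lψ := by
    rw [innerSL_apply_norm]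
    exact (h.norm_occGrad_le hγ θ u).trans
      (mul_le_of_le_one_right (h.occGradBound_nonneg hγ) norm_le_one)
  simp only [sum_abs_eq, mul_sub, Finset.sum_sub_distrib]
  exact (Real.le_norm_self _).trans (convex_univ.norm_image_sub_le_of_norm_hasFDerivWithin_le
    (fun θ _ => (h.hasFDerivAt_sum_mul_occ hγ θ u).hasFDerivWithinAt)
    (fun θ _ => norm_grad_le θ) (Set.mem_univ θ') (Set.mem_univ θ))

end PolicyRegular

end Problem

theorem add_inner_sub_mul_norm_sq_le {V : Type*} [NormedAddCommGroup V] [InnerProductSpace ℝ V]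
    {f : V → ℝ} {g : V → V} {L : ℝ} (hL : 0 ≤ L)
    (hf : ∀ x, HasFDerivAt f (innerSL ℝ (g x)) x) (hg : ∀ x y, ‖g x - g y‖ ≤ L * ‖x - y‖)
    (x v : V) : f x + inner ℝ (g x) v - L * ‖v‖ ^ 2 ≤ f (x + v) := by
  have remainder_le : ‖f (x + v) - f x - innerSL ℝ (g x) (x + v - x)‖ ≤
      L * ‖v‖ * ‖x + v - x‖ := by
    refine (convex_closedBall x ‖v‖).norm_image_sub_le_of_norm_hasFDerivWithin_le'
      (fun y _ => (hf y).hasFDerivWithinAt) (fun y hy => ?_)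
      (Metric.mem_closedBall_self (norm_nonneg v)) (by simp)
    rw [← map_sub, innerSL_apply_norm]
    exact (hg y x).trans (mul_le_mul_of_nonneg_left (mem_closedBall_iff_norm.mp hy) hL)
  rw [add_sub_cancel_left, innerSL_apply_apply] at remainder_le
  linarith [neg_le_of_abs_le remainder_le]

/-- A Lipschitz constant of `θ ↦ ∇F(λ(θ))` for the sup norm. -/
def driftConst (γ lψ LF₁ : ℝ) : ℝ := LF₁ * occGradBound γ lψ

/-- A Lipschitz constant of the gradient of the objective. -/
def smoothConst (γ lψ Lψ lF LF₁ : ℝ) : ℝ :=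
  occGradBound γ lψ * driftConst γ lψ LF₁ + occHessBound γ lψ Lψ * lF

/-- The constant of the bound on the mean squared error of the policy gradient estimate. -/
def estimateConst (γ lψ : ℝ) : ℝ := 4 * (occGradBound √γ lψ ^ 2 + occGradBound γ lψ ^ 2)

theorem smoothConst_nonneg {γ lψ Lψ lF LF₁ : ℝ} (hγ : γ ∈ Set.Ioo 0 1) (hlψ : 0 ≤ lψ)
    (hLψ : 0 ≤ Lψ) (hlF : 0 ≤ lF) (hLF₁ : 0 ≤ LF₁) : 0 ≤ smoothConst γ lψ Lψ lF LF₁ := by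
  have := momentSum_nonneg hγ 1
  have := momentSum_nonneg hγ 2
  unfold smoothConst driftConst occGradBound occHessBound
  positivity

theorem estimateConst_nonneg (γ lψ : ℝ) : 0 ≤ estimateConst γ lψ := by
  unfold estimateConst
  positivity

namespace Problem

variable {S A : Type*} [Fintype S] [Fintype A] {d m : ℕ} {M : Problem S A d m}

theorem pgEstimate_eq_sum_sum {H : ℕ} (τ : Fin H → S × A) (θ : E d)
    (r : EuclideanSpace ℝ (S × A)) :
    M.pgEstimate τ θ r = ∑ h : Fin H, ∑ t : Fin H,
      if t ≤ h then (M.γ ^ (h : ℕ) * r (τ h)) • M.score θ (τ t).1 (τ t).2 else 0 := by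
  rw [Finset.sum_comm, pgEstimate]
  refine Finset.sum_congr rfl fun t _ => ?_
  rw [Finset.sum_smul, ← Finset.sum_filter]
  exact Finset.sum_congr (by ext; simp) fun _ _ => rfl

theorem pgEstimate_succ {H : ℕ} (τ : Fin (H + 1) → S × A) (θ : E d)
    (r : EuclideanSpace ℝ (S × A)) :
    M.pgEstimate τ θ r = M.pgEstimate (Fin.init τ) θ r +
      M.γ ^ H • (r (τ (Fin.last H)) • M.trajScore θ τ) := by
  rw [pgEstimate_eq_sum_sum, Fin.sum_univ_castSucc, pgEstimate_eq_sum_sum]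
  congr 1
  · refine Finset.sum_congr rfl fun h _ => ?_
    rw [Fin.sum_univ_castSucc, if_neg (by simp), add_zero]
    rfl
  · simp only [Fin.le_last, if_true, Fin.val_last, ← Finset.smul_sum, mul_smul, trajScore]

variable [Nonempty A]

/-- The regularity of the policies and of the utility, which is what the analysis of the exact
objective and of the policy gradient estimate needs; it says nothing about the features. -/
structure IsRegular (M : Problem S A d m) (lψ Lψ lF LF LF₁ : ℝ) : Prop where
  discount_mem : M.γ ∈ Set.Ioo 0 1
  policy : M.PolicyRegular lψ Lψ
  utility : M.UtilityRegular lF LF LF₁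
  lipschitzConst_nonneg : 0 ≤ LF₁

/-- The vector `∇F(λ(θ))`. As a function `S × A → ℝ` it carries the sup norm. -/
def utilityGrad (M : Problem S A d m) (θ : E d) : S × A → ℝ :=
  WithLp.ofLp (gradient M.F (M.occ (M.policy θ)))

/-- The distance, in sup norm, from `r` to `∇F(λ(θ))`. -/
def utilityError (M : Problem S A d m) (θ : E d) (r : EuclideanSpace ℝ (S × A)) : ℝ :=
  ‖WithLp.ofLp r - M.utilityGrad θ‖

/-- The policy gradient estimate averaged over a batch of trajectories. -/
def batchEstimate (M : Problem S A d m) {N H : ℕ} (τ : Fin N → Fin H → S × A) (θ : E d)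
    (r : EuclideanSpace ℝ (S × A)) : E d :=
  (1 / (N : ℝ)) • ∑ i, M.pgEstimate (τ i) θ r

theorem expect_pgEstimate (H : ℕ) (θ : E d) (r : EuclideanSpace ℝ (S × A)) :
    (expect (M.trajLaw (M.policy θ) H) fun τ => M.pgEstimate τ θ r) =
      M.occGradTrunc H θ (WithLp.ofLp r) := by
  induction H with
  | zero => simp [trajLaw, expect_pure, pgEstimate, occGradTrunc]
  | succ H ih =>
    simp only [pgEstimate_succ]
    rw [expect_add, expect_trajLaw_init (M.policy θ) H fun τ => M.pgEstimate τ θ r, ih,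
      expect_smul, occGradTrunc, occGradTrunc, Finset.sum_range_succ, pairGrad]

theorem PolicyRegular.norm_pgEstimate_le {lψ Lψ : ℝ} (h : M.PolicyRegular lψ Lψ)
    (hγ : M.γ ∈ Set.Ioo 0 1) {H : ℕ} (τ : Fin H → S × A) (θ : E d)
    (r : EuclideanSpace ℝ (S × A)) :
    ‖M.pgEstimate τ θ r‖ ≤ occGradBound M.γ lψ * ‖WithLp.ofLp r‖ := by
  have lψ_nonneg := h.gradBound_nonneg
  have γ_nonneg := hγ.1.le
  have norm_le_sum : ‖M.pgEstimate τ θ r‖ ≤ 2 * lψ * ‖WithLp.ofLp r‖ *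
      ∑ t ∈ Finset.range H, M.γ ^ t * ((t : ℝ) + 1) ^ 1 := by
    induction H with
    | zero => simp [pgEstimate]
    | succ H ih =>
      rw [pgEstimate_succ, Finset.sum_range_succ, mul_add]
      refine (norm_add_le _ _).trans (add_le_add (ih _) ?_)
      rw [norm_smul, norm_smul, norm_pow, Real.norm_of_nonneg γ_nonneg]
      calc _ ≤ M.γ ^ H * (‖WithLp.ofLp r‖ * (2 * lψ * ((H : ℝ) + 1))) := by
            gcongr
            · exact norm_le_pi_norm (WithLp.ofLp r) (τ (Fin.last H))
            · exact_mod_cast h.norm_trajScore_le θ τ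
        _ = _ := by ring
  calc _ ≤ 2 * lψ * ‖WithLp.ofLp r‖ * momentSum M.γ 1 := norm_le_sum.trans <|
        mul_le_mul_of_nonneg_left (sum_range_le_momentSum hγ 1 H) (by positivity)
    _ = occGradBound M.γ lψ * ‖WithLp.ofLp r‖ := by rw [occGradBound]; ring

namespace IsRegular

variable {lψ Lψ lF LF LF₁ : ℝ} (h : M.IsRegular lψ Lψ lF LF LF₁)

include h

theorem norm_utilityGrad_le (θ : E d) : ‖M.utilityGrad θ‖ ≤ lF :=
  h.utility.grad_le _ ⟨_, rfl⟩

theorem utilityBound_nonneg : 0 ≤ lF := (norm_nonneg _).trans (h.norm_utilityGrad_le 0)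

theorem smoothConst_nonneg : 0 ≤ smoothConst M.γ lψ Lψ lF LF₁ :=
  GenUtilityRL.smoothConst_nonneg h.discount_mem h.policy.gradBound_nonneg h.policy.hessBound_nonneg
    h.utilityBound_nonneg h.lipschitzConst_nonneg

theorem norm_utilityGrad_sub_le (θ θ' : E d) :
    ‖M.utilityGrad θ - M.utilityGrad θ'‖ ≤ driftConst M.γ lψ LF₁ * ‖θ - θ'‖ := by
  refine (h.utility.lipschitz_one _ (Or.inl ⟨_, rfl⟩) _ (Or.inl ⟨_, rfl⟩)).trans ?_
  rw [driftConst, mul_assoc]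
  exact mul_le_mul_of_nonneg_left (h.policy.sum_abs_occ_sub_le h.discount_mem θ θ')
    h.lipschitzConst_nonneg

theorem hasGradientAt_objective (θ : E d) :
    HasGradientAt M.objective (M.occGrad θ (M.utilityGrad θ)) θ := by
  classical
  set g := gradient M.F (M.occ (M.policy θ))
  have hasFDerivAt_F : HasFDerivAt M.F (innerSL ℝ g) (M.occ (M.policy θ)) :=
    (h.utility.differentiableAt _ (Or.inl ⟨_, rfl⟩)).hasGradientAt.hasFDerivAt
  have differentiableAt_occ : DifferentiableAt ℝ (fun θ' => M.occ (M.policy θ')) θ :=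
    differentiableAt_euclidean.mpr fun p => by
      simpa [Pi.single_apply] using
        (h.policy.hasFDerivAt_sum_mul_occ h.discount_mem θ (Pi.single p 1)).differentiableAt
  have inner_occ_eq : innerSL ℝ g ∘ (fun θ' => M.occ (M.policy θ')) =
      fun θ' => ∑ p, g p * M.occ (M.policy θ') p := by
    funext θ'
    simp [PiLp.inner_apply, mul_comm]
  have hasFDerivAt_inner_occ := (innerSL ℝ g).hasFDerivAt.comp θ differentiableAt_occ.hasFDerivAt
  rw [inner_occ_eq] at hasFDerivAt_inner_occ
  exact (hasFDerivAt_F.comp θ differentiableAt_occ.hasFDerivAt).congr_fderiv <|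
    hasFDerivAt_inner_occ.unique <|
      h.policy.hasFDerivAt_sum_mul_occ h.discount_mem θ (M.utilityGrad θ)

theorem gradient_objective (θ : E d) :
    gradient M.objective θ = M.occGrad θ (M.utilityGrad θ) :=
  (h.hasGradientAt_objective θ).gradient

theorem norm_gradient_objective_le (θ : E d) :
    ‖gradient M.objective θ‖ ≤ occGradBound M.γ lψ * lF := by
  rw [h.gradient_objective]
  exact (h.policy.norm_occGrad_le h.discount_mem θ _).trans <|
    mul_le_mul_of_nonneg_left (h.norm_utilityGrad_le θ)
      (h.policy.occGradBound_nonneg h.discount_mem)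

theorem norm_gradient_objective_sub_le (θ θ' : E d) :
    ‖gradient M.objective θ - gradient M.objective θ'‖ ≤
      smoothConst M.γ lψ Lψ lF LF₁ * ‖θ - θ'‖ := by
  rw [h.gradient_objective, h.gradient_objective]
  have occGradBound_nonneg := h.policy.occGradBound_nonneg h.discount_mem
  have occHessBound_nonneg := h.policy.occHessBound_nonneg h.discount_mem
  calc ‖M.occGrad θ (M.utilityGrad θ) - M.occGrad θ' (M.utilityGrad θ')‖
      ≤ ‖M.occGrad θ (M.utilityGrad θ) - M.occGrad θ (M.utilityGrad θ')‖ +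
          ‖M.occGrad θ (M.utilityGrad θ') - M.occGrad θ' (M.utilityGrad θ')‖ :=
        norm_sub_le_norm_sub_add_norm_sub _ _ _
    _ ≤ occGradBound M.γ lψ * ‖M.utilityGrad θ - M.utilityGrad θ'‖ +
          occHessBound M.γ lψ Lψ * ‖M.utilityGrad θ'‖ * ‖θ - θ'‖ :=
        add_le_add (h.policy.norm_occGrad_sub_arg_le h.discount_mem _ _ _)
          (h.policy.norm_occGrad_sub_le h.discount_mem _ _ _)
    _ ≤ occGradBound M.γ lψ * (driftConst M.γ lψ LF₁ * ‖θ - θ'‖) +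
          occHessBound M.γ lψ Lψ * lF * ‖θ - θ'‖ := by
        gcongr
        · exact h.norm_utilityGrad_sub_le θ θ'
        · exact h.norm_utilityGrad_le θ'
    _ = smoothConst M.γ lψ Lψ lF LF₁ * ‖θ - θ'‖ := by rw [smoothConst]; ring

theorem objective_add_inner_sub_le (θ v : E d) :
    M.objective θ + inner ℝ (gradient M.objective θ) v -
      smoothConst M.γ lψ Lψ lF LF₁ * ‖v‖ ^ 2 ≤ M.objective (θ + v) :=
  add_inner_sub_mul_norm_sq_le h.smoothConst_nonneg
    (fun θ => (h.hasGradientAt_objective θ).differentiableAt.hasGradientAt.hasFDerivAt)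
    h.norm_gradient_objective_sub_le θ v

theorem norm_le_add_utilityError (θ : E d) (r : EuclideanSpace ℝ (S × A)) :
    ‖WithLp.ofLp r‖ ≤ lF + M.utilityError θ r :=
  calc ‖WithLp.ofLp r‖ ≤ ‖M.utilityGrad θ‖ + ‖WithLp.ofLp r - M.utilityGrad θ‖ :=
        norm_le_norm_add_norm_sub' _ _
    _ ≤ lF + M.utilityError θ r := add_le_add_left (h.norm_utilityGrad_le θ) _

theorem norm_occGradTrunc_sub_gradient_le (H : ℕ) (θ : E d) (r : EuclideanSpace ℝ (S × A)) :
    ‖M.occGradTrunc H θ (WithLp.ofLp r) - gradient M.objective θ‖ ≤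
      √M.γ ^ H * (occGradBound √M.γ lψ * ‖WithLp.ofLp r‖) +
        occGradBound M.γ lψ * M.utilityError θ r := by
  rw [h.gradient_objective]
  refine (norm_sub_le_norm_sub_add_norm_sub _ (M.occGrad θ (WithLp.ofLp r)) _).trans
    (add_le_add ?_ (h.policy.norm_occGrad_sub_arg_le h.discount_mem θ _ _))
  rw [norm_sub_rev]
  exact h.policy.norm_occGrad_sub_occGradTrunc_le h.discount_mem θ _ H

theorem expect_norm_batchEstimate_sub_gradient_sq_le (H : ℕ) (θ : E d)
    (r : EuclideanSpace ℝ (S × A)) {N : ℕ} (hN : N ≠ 0) :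
    (expect (iid (M.trajLaw (M.policy θ) H) N) fun τ =>
        ‖M.batchEstimate τ θ r - gradient M.objective θ‖ ^ 2) ≤
      estimateConst M.γ lψ * (M.utilityError θ r ^ 2 + lF ^ 2 * (M.γ ^ H + 1 / N)) := by
  set R := ‖WithLp.ofLp r‖
  set u := M.utilityError θ r
  set c := occGradBound M.γ lψ
  set s := occGradBound √M.γ lψ
  have norm_sq_le : R ^ 2 ≤ 2 * (lF ^ 2 + u ^ 2) :=
    (pow_le_pow_left₀ (norm_nonneg _) (h.norm_le_add_utilityError θ r) 2).trans add_sq_le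
  have bias_le : ‖M.occGradTrunc H θ (WithLp.ofLp r) - gradient M.objective θ‖ ^ 2 ≤
      2 * (M.γ ^ H * s ^ 2 * R ^ 2 + c ^ 2 * u ^ 2) := by
    refine (pow_le_pow_left₀ (norm_nonneg _)
      (h.norm_occGradTrunc_sub_gradient_le H θ r) 2).trans (add_sq_le.trans_eq ?_)
    rw [← sqrt_pow_sq h.discount_mem]
    ring
  have second_moment_le : (expect (M.trajLaw (M.policy θ) H) fun τ => ‖M.pgEstimate τ θ r‖ ^ 2) ≤
      c ^ 2 * R ^ 2 := by
    rw [← mul_pow]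
    exact expect_le_const _ fun τ => pow_le_pow_left₀ (norm_nonneg _)
      (h.policy.norm_pgEstimate_le h.discount_mem τ θ r) 2
  have γ_nonneg := h.discount_mem.1.le
  have pow_le_one : M.γ ^ H ≤ 1 := pow_le_one₀ γ_nonneg h.discount_mem.2.le
  have inv_le_one : 1 / (N : ℝ) ≤ 1 := by
    rw [div_le_one (by positivity)]
    exact_mod_cast Nat.one_le_iff_ne_zero.mpr hN
  set q := M.γ ^ H
  calc _ ≤ 2 * (q * s ^ 2 * R ^ 2 + c ^ 2 * u ^ 2) + 1 / N * (c ^ 2 * R ^ 2) := by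
        refine (expect_iid_norm_mean_sub_sq_le _ (fun τ => M.pgEstimate τ θ r) _ hN).trans ?_
        rw [expect_pgEstimate]
        gcongr
    _ ≤ 2 * (q * s ^ 2 * (2 * (lF ^ 2 + u ^ 2)) + c ^ 2 * u ^ 2) +
          1 / N * (c ^ 2 * (2 * (lF ^ 2 + u ^ 2))) := by gcongr
    _ = lF ^ 2 * (4 * s ^ 2 * q + 2 * c ^ 2 * (1 / N)) +
          u ^ 2 * (4 * s ^ 2 * q + 2 * c ^ 2 + 2 * c ^ 2 * (1 / N)) := by ring
    _ ≤ lF ^ 2 * (4 * (s ^ 2 + c ^ 2) * q + 4 * (s ^ 2 + c ^ 2) * (1 / N)) +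
          u ^ 2 * (4 * s ^ 2 * 1 + 2 * c ^ 2 + 2 * c ^ 2 * 1) := by
        gcongr <;> nlinarith [sq_nonneg s, sq_nonneg c]
    _ = estimateConst M.γ lψ * (u ^ 2 + lF ^ 2 * (q + 1 / N)) := by rw [estimateConst]; ring

end IsRegular

/-- The Lyapunov function of the method. The error term makes up for the use of the vector
`r_{t-1}` of the previous iteration in the policy gradient estimate. -/
def potential (M : Problem S A d m) (lψ α : ℝ) (θ : E d) (r : EuclideanSpace ℝ (S × A)) : ℝ :=
  estimateConst M.γ lψ / 2 * α * M.utilityError θ r ^ 2 - M.objective θ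

end Problem

/-- The largest step size for which an iteration of the method decreases the Lyapunov function up
to noise. -/
def maxStepSize (γ lψ Lψ lF LF₁ : ℝ) : ℝ :=
  1 / (4 * (smoothConst γ lψ Lψ lF LF₁ + estimateConst γ lψ * driftConst γ lψ LF₁ ^ 2 + 1))

theorem maxStepSize_pos {γ lψ Lψ lF LF₁ : ℝ} (hγ : γ ∈ Set.Ioo 0 1) (hlψ : 0 ≤ lψ) (hLψ : 0 ≤ Lψ)
    (hlF : 0 ≤ lF) (hLF₁ : 0 ≤ LF₁) : 0 < maxStepSize γ lψ Lψ lF LF₁ := by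
  have := smoothConst_nonneg hγ hlψ hLψ hlF hLF₁
  have := estimateConst_nonneg γ lψ
  unfold maxStepSize
  positivity

namespace Problem.IsRegular

variable {S A : Type*} [Fintype S] [Fintype A] [Nonempty A] {d m : ℕ} {M : Problem S A d m}
  {lψ Lψ lF LF LF₁ α : ℝ} (h : M.IsRegular lψ Lψ lF LF LF₁)

include h

theorem utilityError_add_sq_le (θ v : E d) (r : EuclideanSpace ℝ (S × A)) :
    M.utilityError (θ + v) r ^ 2 ≤
      2 * (M.utilityError θ r ^ 2 + driftConst M.γ lψ LF₁ ^ 2 * ‖v‖ ^ 2) := by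
  rw [← mul_pow]
  refine (pow_le_pow_left₀ (norm_nonneg _) ?_ 2).trans add_sq_le
  calc M.utilityError (θ + v) r
      ≤ M.utilityError θ r + ‖M.utilityGrad θ - M.utilityGrad (θ + v)‖ :=
        norm_sub_le_norm_sub_add_norm_sub _ _ _
    _ ≤ M.utilityError θ r + driftConst M.γ lψ LF₁ * ‖θ - (θ + v)‖ := by
        gcongr
        exact h.norm_utilityGrad_sub_le θ (θ + v)
    _ = M.utilityError θ r + driftConst M.γ lψ LF₁ * ‖v‖ := by
        rw [sub_add_cancel_left, norm_neg]

variable (hα : 0 ≤ α) (hα_le : α ≤ maxStepSize M.γ lψ Lψ lF LF₁)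

include hα hα_le

theorem step_size_bounds : smoothConst M.γ lψ Lψ lF LF₁ * α ≤ 1 / 4 ∧
    estimateConst M.γ lψ * driftConst M.γ lψ LF₁ ^ 2 * α ^ 2 ≤ 1 / 4 := by
  have smooth_nonneg := h.smoothConst_nonneg
  have drift_nonneg : 0 ≤ estimateConst M.γ lψ * driftConst M.γ lψ LF₁ ^ 2 :=
    mul_nonneg (estimateConst_nonneg _ _) (sq_nonneg _)
  rw [maxStepSize, le_div_iff₀ (by positivity)] at hα_le
  have le_one : α ≤ 1 := by nlinarith
  have : α ^ 2 ≤ α := pow_le_of_le_one hα le_one two_ne_zero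
  constructor <;> nlinarith

theorem potential_step_le (θ g : E d) (r : EuclideanSpace ℝ (S × A)) :
    M.potential lψ α (θ + α • g) r ≤
      -M.objective θ - α / 2 * ‖gradient M.objective θ‖ ^ 2 +
        α / 2 * ‖g - gradient M.objective θ‖ ^ 2 +
        estimateConst M.γ lψ * α * M.utilityError θ r ^ 2 := by
  obtain ⟨smooth_le, drift_le⟩ := h.step_size_bounds hα hα_le
  have ascent := h.objective_add_inner_sub_le θ (α • g)
  have drift := mul_le_mul_of_nonneg_left (h.utilityError_add_sq_le θ (α • g) r)
    (by have := estimateConst_nonneg M.γ lψ; positivity : 0 ≤ estimateConst M.γ lψ / 2 * α)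
  have polarization := norm_sub_sq_real g (gradient M.objective θ)
  rw [real_inner_comm] at polarization
  rw [inner_smul_right, norm_smul, Real.norm_of_nonneg hα] at ascent
  rw [norm_smul, Real.norm_of_nonneg hα] at drift
  have smooth_mul_le := mul_le_mul_of_nonneg_right smooth_le (by positivity : 0 ≤ α * ‖g‖ ^ 2)
  have drift_mul_le := mul_le_mul_of_nonneg_right drift_le (by positivity : 0 ≤ α * ‖g‖ ^ 2)
  rw [potential]
  linear_combination ascent + drift + smooth_mul_le + drift_mul_le - α / 2 * polarization

end Problem.IsRegular

/-- A bound on the minimizer of the regression loss. -/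
def minimizerBound (γ B μ : ℝ) : ℝ := B * (1 - γ)⁻¹ / μ

/-- A bound on the residuals of the Monte Carlo estimates of `λ_H` at the minimizer of the
regression loss. -/
def residualBound (γ B μ : ℝ) : ℝ := B * minimizerBound γ B μ + (1 - γ)⁻¹

/-- A bound on the mean squared distance of the SGD iterates to the minimizer of the regression
loss. -/
def iterateBound (γ B μ : ℝ) : ℝ :=
  minimizerBound γ B μ ^ 2 + residualBound γ B μ ^ 2 / (2 * μ)

/-- The constant `c` in the bound `c / K` for the mean squared error of averaged SGD with `K` steps
of size `1 / (8 B²)`. -/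
def regressionConst (γ B μ : ℝ) : ℝ :=
  (4 * B ^ 2 * (B ^ 2 * iterateBound γ B μ + residualBound γ B μ ^ 2) +
    32 * iterateBound γ B μ / (2 * (1 / (8 * B ^ 2))) ^ 2) / μ ^ 2

/-- The constant in the bound for the mean squared error of the estimate of `∇F(λ(θ))`, where `nA`
is the number of actions. -/
def utilityErrorConst (γ LF nA ρmin B μ : ℝ) : ℝ :=
  2 * LF ^ 2 * (nA / ρmin * (1 + B ^ 2 * regressionConst γ B μ) + momentSum √γ 1 ^ 2)

theorem regressionConst_nonneg (γ B : ℝ) {μ : ℝ} (hμ : 0 < μ) : 0 ≤ regressionConst γ B μ := by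
  unfold regressionConst iterateBound
  positivity

theorem norm_euclidean_le_sum_abs {ι : Type*} [Fintype ι] (x : EuclideanSpace ℝ ι) :
    ‖x‖ ≤ ∑ i, |x i| := by
  refine le_of_sq_le_sq ?_ (Finset.sum_nonneg fun i _ => abs_nonneg _)
  rw [EuclideanSpace.norm_sq_eq]
  exact Finset.sum_sq_le_sq_sum_of_nonneg fun i _ => abs_nonneg _

namespace Problem

variable {S A : Type*} [Fintype S] [Fintype A] {d m : ℕ} {M : Problem S A d m}

section MonteCarlo

variable [DecidableEq S] [DecidableEq A]

theorem mcOcc_eq_sum_mul {H : ℕ} (τ : Fin H → S × A) (p : S × A) :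
    M.mcOcc τ p = ∑ h : Fin H, M.γ ^ (h : ℕ) * if τ h = p then (1 : ℝ) else 0 := by
  simp only [mcOcc, mul_ite, mul_one, mul_zero]

theorem abs_mcOcc_le (hγ : M.γ ∈ Set.Ioo 0 1) {H : ℕ} (τ : Fin H → S × A) (p : S × A) :
    |M.mcOcc τ p| ≤ (1 - M.γ)⁻¹ := by
  have pow_nonneg (h : ℕ) : 0 ≤ M.γ ^ h := pow_nonneg hγ.1.le h
  calc |M.mcOcc τ p| ≤ ∑ h : Fin H, |if τ h = p then M.γ ^ (h : ℕ) else 0| :=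
        Finset.abs_sum_le_sum_abs _ _
    _ ≤ ∑ h : Fin H, M.γ ^ (h : ℕ) := Finset.sum_le_sum fun h _ => by
        split_ifs
        · rw [abs_of_nonneg (pow_nonneg h)]
        · rw [abs_zero]
          exact pow_nonneg h
    _ = ∑ h ∈ Finset.range H, M.γ ^ h := Fin.sum_univ_eq_sum_range _ H
    _ ≤ (1 - M.γ)⁻¹ := sum_range_pow_le_inv_one_sub hγ H

theorem expect_mcOcc (π : S → PMF A) (H : ℕ) (p : S × A) :
    (expect (M.trajLaw π H) fun τ => M.mcOcc τ p) = M.occTrunc H π p := by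
  simp only [mcOcc_eq_sum_mul]
  rw [expect_trajLaw_sum π H fun q => if q = p then (1 : ℝ) else 0]
  simp [expect_eq_sum, occTrunc]

end MonteCarlo

variable [Nonempty A]

theorem queryLaw_toReal (p : S × A) :
    (M.queryLaw p).toReal = (M.ρ p.1).toReal / Fintype.card A := by
  classical
  have pure_ne {s : S} {a : A} (ne : ¬(s = p.1 ∧ a = p.2)) : PMF.pure (s, a) p = 0 := by
    rw [PMF.pure_apply, if_neg fun eq => ne ⟨congrArg Prod.fst eq.symm, congrArg Prod.snd eq.symm⟩]
  rw [queryLaw, bind_apply_eq_mul (x := p.1), bind_apply_eq_mul (x := p.2)]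
  · simp [div_eq_mul_inv]
  · exact fun a ha => pure_ne fun eq => ha eq.2
  · intro s hs
    rw [PMF.bind_apply, ENNReal.tsum_eq_zero]
    exact fun a => by rw [pure_ne fun eq => hs eq.1, mul_zero]

theorem le_queryLaw {ρmin : ℝ} (hρ : ∀ s, ρmin ≤ (M.ρ s).toReal) (p : S × A) :
    ρmin / Fintype.card A ≤ (M.queryLaw p).toReal := by
  rw [queryLaw_toReal]
  gcongr
  exact hρ _

theorem FeatureRegular.le_expect_inner_sq {B μ : ℝ} (h : M.FeatureRegular B μ) (v : E m) :
    μ * ‖v‖ ^ 2 ≤ expect M.queryLaw fun p => inner ℝ (M.φ p) v ^ 2 := by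
  have inner_eq_dotProduct (x y : E m) : inner ℝ x y = WithLp.ofLp x ⬝ᵥ WithLp.ofLp y := by
    rw [EuclideanSpace.inner_eq_star_dotProduct, dotProduct_comm, star_trivial]
  have quadratic_form_nonneg := h.cov.dotProduct_mulVec_nonneg (WithLp.ofLp v)
  simp only [Matrix.sub_mulVec, Matrix.sum_mulVec, Matrix.smul_mulVec, Matrix.one_mulVec,
    Matrix.vecMulVec_mulVec, dotProduct_sub, dotProduct_sum, dotProduct_smul, star_trivial,
    op_smul_eq_smul] at quadratic_form_nonneg
  simp only [← inner_eq_dotProduct, real_inner_self_eq_norm_sq, real_inner_comm _ v, smul_eq_mul,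
    ← sq] at quadratic_form_nonneg
  simp only [expect_eq_sum, smul_eq_mul]
  exact sub_nonneg.mp quadratic_form_nonneg

theorem lsLoss_queryLaw (H : ℕ) (θ : E d) (ω : E m) :
    lsLoss M.queryLaw M.φ (M.occTrunc H (M.policy θ)) ω = M.regLoss H θ ω :=
  expect_eq_sum _ _

theorem expect_lsGrad_queryLaw_eq_zero {H : ℕ} {θ : E d} {w : E m}
    (hw : ∀ ω, M.regLoss H θ w ≤ M.regLoss H θ ω) :
    expect M.queryLaw (lsGrad M.φ (M.occTrunc H (M.policy θ)) w) = 0 :=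
  expect_lsGrad_eq_zero_of_forall_le _ fun ω => by simpa only [lsLoss_queryLaw] using hw ω

theorem regLoss_nonneg (H : ℕ) (θ : E d) (ω : E m) : 0 ≤ M.regLoss H θ ω :=
  Finset.sum_nonneg fun _ _ => mul_nonneg ENNReal.toReal_nonneg (sq_nonneg _)

theorem norm_linApprox_sub_occTrunc_sq_le {ρmin : ℝ} (hρ_pos : 0 < ρmin)
    (hρ : ∀ s, ρmin ≤ (M.ρ s).toReal) (H : ℕ) (θ : E d) (ω : E m) :
    ‖M.linApprox ω - M.occTrunc H (M.policy θ)‖ ^ 2 ≤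
      Fintype.card A / ρmin * M.regLoss H θ ω := by
  have weighted_le : ρmin / Fintype.card A * ‖M.linApprox ω - M.occTrunc H (M.policy θ)‖ ^ 2 ≤
      M.regLoss H θ ω := by
    rw [EuclideanSpace.norm_sq_eq, Finset.mul_sum, regLoss]
    refine Finset.sum_le_sum fun p _ => ?_
    rw [Real.norm_eq_abs, sq_abs, PiLp.sub_apply, sub_sq_comm]
    exact mul_le_mul_of_nonneg_right (le_queryLaw hρ p) (sq_nonneg _)
  have : (0 : ℝ) < Fintype.card A := Nat.cast_pos.mpr Fintype.card_pos
  calc _ = Fintype.card A / ρmin *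
        (ρmin / Fintype.card A * ‖M.linApprox ω - M.occTrunc H (M.policy θ)‖ ^ 2) := by field_simp
    _ ≤ _ := by gcongr

theorem UtilityRegular.utilityError_gradient_linApprox_sq_le {lF LF LF₁ : ℝ}
    (h : M.UtilityRegular lF LF LF₁) (hγ : M.γ ∈ Set.Ioo 0 1) (H : ℕ) (θ : E d) (ω : E m) :
    M.utilityError θ (gradient M.F (M.linApprox ω)) ^ 2 ≤
      2 * LF ^ 2 * (‖M.linApprox ω - M.occTrunc H (M.policy θ)‖ ^ 2 +
        momentSum √M.γ 1 ^ 2 * M.γ ^ H) := by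
  set x := M.linApprox ω
  set y := M.occ (M.policy θ)
  set z := M.occTrunc H (M.policy θ)
  have truncation_le : ‖z - y‖ ≤ √M.γ ^ H * momentSum √M.γ 1 := by
    rw [norm_sub_rev]
    exact (norm_euclidean_le_sum_abs _).trans (sum_abs_occ_sub_occTrunc_le hγ _ _)
  calc M.utilityError θ (gradient M.F x) ^ 2 ≤ (LF * ‖x - y‖) ^ 2 :=
        pow_le_pow_left₀ (norm_nonneg _) (h.lipschitz_two x (Or.inr ⟨ω, rfl⟩) y (Or.inl ⟨_, rfl⟩)) 2
    _ = LF ^ 2 * ‖(x - z) + (z - y)‖ ^ 2 := by rw [mul_pow, sub_add_sub_cancel]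
    _ ≤ LF ^ 2 * (2 * ‖x - z‖ ^ 2 + 2 * (√M.γ ^ H * momentSum √M.γ 1) ^ 2) := by
        gcongr
        refine (norm_add_sq_le _ _).trans ?_
        gcongr
    _ = _ := by
        rw [mul_pow, sqrt_pow_sq hγ]
        ring

/-- The joint law of the query and the trajectory that an iteration of the regression draws. -/
def sampleLaw (M : Problem S A d m) (H : ℕ) (θ : E d) : PMF ((S × A) × (Fin H → S × A)) :=
  M.queryLaw.bind fun p => (M.trajLaw (M.policy θ) H).map fun τ => (p, τ)

theorem expect_sampleLaw {V : Type*} [NormedAddCommGroup V] [NormedSpace ℝ V] (H : ℕ) (θ : E d)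
    (f : (S × A) × (Fin H → S × A) → V) :
    expect (M.sampleLaw H θ) f =
      expect M.queryLaw fun p => expect (M.trajLaw (M.policy θ) H) fun τ => f (p, τ) := by
  simp only [sampleLaw, expect_bind, expect_map]

variable [DecidableEq S] [DecidableEq A]

theorem expect_lsGrad_sampleLaw (H : ℕ) (θ : E d) (ω : E m) :
    expect (M.sampleLaw H θ) (lsGrad (fun z => M.φ z.1) (fun z => M.mcOcc z.2 z.1) ω) =
      expect M.queryLaw (lsGrad M.φ (M.occTrunc H (M.policy θ)) ω) := by
  rw [expect_sampleLaw]
  refine expect_congr _ fun p => ?_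
  have factor := expect_clm (M.trajLaw (M.policy θ) H)
    (ContinuousLinearMap.toSpanSingleton ℝ (M.φ p)) fun τ => inner ℝ (M.φ p) ω - M.mcOcc τ p
  rw [expect_sub, expect_const, expect_mcOcc] at factor
  exact factor

-- The factor `2` comes from the loss not being halved.
theorem map_sgdLaw (β : ℝ) (H : ℕ) (θ : E d) (k : ℕ) :
    (M.sgdLaw 0 β H θ k).map (fun x => (x.iterate, x.total)) =
      lsSGD (M.sampleLaw H θ) (fun z => M.φ z.1) (fun z => M.mcOcc z.2 z.1) (2 * β) k := by
  induction k with
  | zero => exact PMF.pure_map _ _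
  | succ k ih =>
    have step_eq (x : SGDState m) (p : S × A) (τ : Fin H → S × A) :
        lsSGDStep (fun z : (S × A) × (Fin H → S × A) => M.φ z.1) (fun z => M.mcOcc z.2 z.1) (2 * β)
          (x.iterate, x.total) (p, τ) =
        (x.iterate - β • (2 * (inner ℝ (M.φ p) x.iterate - M.mcOcc τ p)) • M.φ p,
          x.total + (x.iterate - β • (2 * (inner ℝ (M.φ p) x.iterate - M.mcOcc τ p)) • M.φ p)) := by
      simp only [lsSGDStep, lsGrad, smul_smul, mul_left_comm β, mul_assoc]
    rw [lsSGD, ← ih, PMF.bind_map]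
    simp only [sgdLaw, sampleLaw, ← PMF.bind_pure_comp, PMF.bind_bind, PMF.pure_bind,
      Function.comp_def, step_eq]

instance finite_support_sgdLaw (ω₀ : E m) (β : ℝ) (H : ℕ) (θ : E d) :
    ∀ k, Finite (M.sgdLaw ω₀ β H θ k).support
  | 0 => finite_support_pure _
  | k + 1 => by
    have := finite_support_sgdLaw ω₀ β H θ k
    unfold sgdLaw
    infer_instance

instance finite_support_sgdOutput (ω₀ : E m) (β : ℝ) (K H : ℕ) (θ : E d) :
    Finite (M.sgdOutput ω₀ β K H θ).support :=
  finite_support_map _ _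

theorem expect_sgdOutput_fst (β : ℝ) (K H : ℕ) (θ : E d) (f : E m → ℝ) :
    (expect (M.sgdOutput 0 β K H θ) fun y => f y.1) =
      expect (lsSGD (M.sampleLaw H θ) (fun z => M.φ z.1) (fun z => M.mcOcc z.2 z.1) (2 * β) K)
        fun x => f ((1 / K : ℝ) • x.2) := by
  rw [← map_sgdLaw, sgdOutput, expect_map, expect_map]

section Regression

variable {B μ : ℝ} (hφ : M.FeatureRegular B μ) (hB : 0 < B) (hμ : 0 < μ) (hγ : M.γ ∈ Set.Ioo 0 1)
  {H : ℕ} {θ : E d} {w : E m} (hw : ∀ ω, M.regLoss H θ w ≤ M.regLoss H θ ω)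

include hφ hB hμ hγ hw

theorem isRegularLeastSquares_sampleLaw :
    ‖w‖ ≤ minimizerBound M.γ B μ ∧
      IsRegularLeastSquares (M.sampleLaw H θ) (fun z => M.φ z.1) (fun z => M.mcOcc z.2 z.1) w B μ
        (residualBound M.γ B μ) := by
  have normal_eq :
      expect (M.sampleLaw H θ) (lsGrad (fun z => M.φ z.1) (fun z => M.mcOcc z.2 z.1) w) = 0 := by
    rw [expect_lsGrad_sampleLaw, expect_lsGrad_queryLaw_eq_zero hw]
  have coercive (v : E m) :
      μ * ‖v‖ ^ 2 ≤ expect (M.sampleLaw H θ) fun z => inner ℝ (M.φ z.1) v ^ 2 := by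
    simpa only [expect_sampleLaw, expect_const] using hφ.le_expect_inner_sq v
  have norm_le : ‖w‖ ≤ minimizerBound M.γ B μ := by
    have := mul_norm_le_of_expect_lsGrad_eq_zero (M.sampleLaw H θ) (a := fun z => M.φ z.1)
      (y := fun z => M.mcOcc z.2 z.1) (fun z => hφ.norm_le z.1) coercive
      (fun z => abs_mcOcc_le hγ z.2 z.1) normal_eq
    rw [minimizerBound, le_div_iff₀ hμ]
    linarith
  refine ⟨norm_le, fun z => hφ.norm_le z.1, coercive, normal_eq, fun z => ?_⟩
  calc |inner ℝ (M.φ z.1) w - M.mcOcc z.2 z.1|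
      ≤ |inner ℝ (M.φ z.1) w| + |M.mcOcc z.2 z.1| := abs_sub _ _
    _ ≤ B * minimizerBound M.γ B μ + (1 - M.γ)⁻¹ := by
        refine add_le_add ((abs_real_inner_le_norm _ _).trans ?_) (abs_mcOcc_le hγ _ _)
        exact mul_le_mul (hφ.norm_le _) norm_le (norm_nonneg _) hB.le

theorem expect_norm_sgdOutput_sub_sq_le {K : ℕ} (hK : K ≠ 0) :
    (expect (M.sgdOutput 0 (1 / (8 * B ^ 2)) K H θ) fun y => ‖y.1 - w‖ ^ 2) ≤
      regressionConst M.γ B μ / K := by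
  obtain ⟨norm_le, regular⟩ := isRegularLeastSquares_sampleLaw hφ hB hμ hγ hw
  rw [expect_sgdOutput_fst _ _ _ _ fun ω => ‖ω - w‖ ^ 2]
  refine regular.expect_norm_average_sub_sq_le hμ (by positivity) (le_of_eq ?_) ?_ hK
  · field_simp
    norm_num
  · rw [iterateBound]
    gcongr

theorem expect_norm_linApprox_sgdOutput_sub_sq_le {ρmin : ℝ} (hρ_pos : 0 < ρmin)
    (hρ : ∀ s, ρmin ≤ (M.ρ s).toReal) {K : ℕ} (hK : K ≠ 0) :
    (expect (M.sgdOutput 0 (1 / (8 * B ^ 2)) K H θ) fun y =>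
        ‖M.linApprox y.1 - M.occTrunc H (M.policy θ)‖ ^ 2) ≤
      Fintype.card A / ρmin * (M.regLoss H θ w + B ^ 2 * (regressionConst M.γ B μ / K)) := by
  have regLoss_le (ω : E m) : M.regLoss H θ ω ≤ M.regLoss H θ w + B ^ 2 * ‖ω - w‖ ^ 2 := by
    simpa only [lsLoss_queryLaw] using
      lsLoss_le_add_norm_sub_sq M.queryLaw hφ.norm_le (expect_lsGrad_queryLaw_eq_zero hw) ω
  calc _ ≤ expect (M.sgdOutput 0 (1 / (8 * B ^ 2)) K H θ) fun y =>
        Fintype.card A / ρmin * (M.regLoss H θ w + B ^ 2 * ‖y.1 - w‖ ^ 2) :=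
        expect_mono _ fun y => (norm_linApprox_sub_occTrunc_sq_le hρ_pos hρ H θ y.1).trans <| by
          gcongr
          exact regLoss_le y.1
    _ ≤ _ := by
        rw [expect_mul, expect_add, expect_const, expect_mul]
        gcongr
        exact expect_norm_sgdOutput_sub_sq_le hφ hB hμ hγ hw hK

theorem expect_utilityError_sgdOutput_sq_le {ρmin lF LF LF₁ : ℝ} (hF : M.UtilityRegular lF LF LF₁)
    (hρ_pos : 0 < ρmin) (hρ : ∀ s, ρmin ≤ (M.ρ s).toReal) {K : ℕ} (hK : K ≠ 0) :
    (expect (M.sgdOutput 0 (1 / (8 * B ^ 2)) K H θ) fun y =>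
        M.utilityError θ (gradient M.F (M.linApprox y.1)) ^ 2) ≤
      utilityErrorConst M.γ LF (Fintype.card A) ρmin B μ *
        (M.regLoss H θ w + 1 / K + M.γ ^ H) := by
  set c := regressionConst M.γ B μ
  set nA : ℝ := (Fintype.card A : ℝ)
  set ℓ := M.regLoss H θ w
  have ℓ_nonneg : 0 ≤ ℓ := regLoss_nonneg H θ w
  calc _ ≤ 2 * LF ^ 2 * ((expect (M.sgdOutput 0 (1 / (8 * B ^ 2)) K H θ) fun y =>
          ‖M.linApprox y.1 - M.occTrunc H (M.policy θ)‖ ^ 2) +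
            momentSum √M.γ 1 ^ 2 * M.γ ^ H) := by
        rw [← expect_const (M.sgdOutput 0 (1 / (8 * B ^ 2)) K H θ)
          (momentSum √M.γ 1 ^ 2 * M.γ ^ H), ← expect_add, ← expect_mul]
        exact expect_mono _ fun y => by
          simpa only [expect_const] using hF.utilityError_gradient_linApprox_sq_le hγ H θ y.1
    _ ≤ 2 * LF ^ 2 * (nA / ρmin * (ℓ + B ^ 2 * (c / K)) + momentSum √M.γ 1 ^ 2 * M.γ ^ H) := by
        gcongr
        exact expect_norm_linApprox_sgdOutput_sub_sq_le hφ hB hμ hγ hw hρ_pos hρ hK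
    _ ≤ 2 * LF ^ 2 * (nA / ρmin * ((1 + B ^ 2 * c) * (ℓ + 1 / K + M.γ ^ H)) +
          momentSum √M.γ 1 ^ 2 * (ℓ + 1 / K + M.γ ^ H)) := by
        have : 0 ≤ B ^ 2 * c := mul_nonneg (sq_nonneg B) (regressionConst_nonneg _ _ hμ)
        have K_inv_nonneg : (0 : ℝ) ≤ 1 / K := by positivity
        have pow_nonneg : 0 ≤ M.γ ^ H := pow_nonneg hγ.1.le H
        gcongr
        · calc ℓ + B ^ 2 * (c / K) = ℓ + B ^ 2 * c * (1 / K) := by ring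
            _ ≤ (1 + B ^ 2 * c) * (ℓ + 1 / K + M.γ ^ H) := by nlinarith
        · linarith
    _ = _ := by
        rw [utilityErrorConst]
        ring

end Regression

end Problem

theorem finite_support_uniformOfFinset {X : Type*} (s : Finset X) (hs : s.Nonempty) :
    Finite (PMF.uniformOfFinset s hs).support := by
  rw [PMF.support_uniformOfFinset]
  exact s.finite_toSet

theorem expect_uniformOfFinset {X : Type*} (s : Finset X) (hs : s.Nonempty) (f : X → ℝ) :
    expect (PMF.uniformOfFinset s hs) f = 1 / s.card * ∑ x ∈ s, f x := by
  classical
  rw [expect, tsum_eq_sum (s := s) fun x hx => by simp [hx], Finset.mul_sum]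
  exact Finset.sum_congr rfl fun x hx => by simp [hx]

theorem mul_sum_range_le_of_step_le {V g : ℕ → ℝ} {a e : ℝ} {T : ℕ}
    (hstep : ∀ t < T, V (t + 1) ≤ V t - a * g t + e) :
    a * ∑ t ∈ Finset.range T, g t ≤ V 0 - V T + T * e := by
  have sum_le : ∑ t ∈ Finset.range T, (a * g t - e) ≤ ∑ t ∈ Finset.range T, (V t - V (t + 1)) :=
    Finset.sum_le_sum fun t ht => by linarith [hstep t (Finset.mem_range.mp ht)]
  rw [Finset.sum_range_sub', Finset.sum_sub_distrib, ← Finset.mul_sum, Finset.sum_const,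
    Finset.card_range, nsmul_eq_mul] at sum_le
  linarith

theorem sum_Icc_le_sum_range_add {f : ℕ → ℝ} (hf : ∀ t, 0 ≤ f t) (T : ℕ) :
    ∑ t ∈ Finset.Icc 1 T, f t ≤ ∑ t ∈ Finset.range T, f t + f T := by
  rw [← Finset.sum_range_succ]
  refine Finset.sum_le_sum_of_subset_of_nonneg (fun t ht => ?_) fun t _ _ => hf t
  simp only [Finset.mem_Icc, Finset.mem_range] at ht ⊢
  lia

/-- The constant of the bound on the mean squared norm of the gradient at the output of the method,
where `nA` is the number of actions. -/
def gradSqConst (γ lψ lF LF α nA ρmin B μ Δ : ℝ) : ℝ :=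
  2 * |Δ| / α + (occGradBound γ lψ * lF) ^ 2 + estimateConst γ lψ * lF ^ 2 +
    3 * estimateConst γ lψ * utilityErrorConst γ LF nA ρmin B μ

namespace Problem

variable {S A : Type*} [Fintype S] [Fintype A] [DecidableEq S] [DecidableEq A] [Nonempty A]
  {d m : ℕ} {M : Problem S A d m}

section Laws

variable (θ₀ : E d) (α : ℝ) (N : ℕ) (ω₀ : E m) (β : ℝ) (K H : ℕ)

instance finite_support_pgLaw : ∀ t, Finite (M.pgLaw θ₀ α N ω₀ β K H t).support
  | 0 => by
    unfold pgLaw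
    infer_instance
  | t + 1 => by
    have := finite_support_pgLaw t
    unfold pgLaw
    infer_instance

instance finite_support_iterateLaw (t : ℕ) : Finite (M.iterateLaw θ₀ α N ω₀ β K H t).support :=
  finite_support_map _ _

instance finite_support_averageLaw (T : ℕ) (hT : 1 ≤ T) :
    Finite (M.averageLaw θ₀ α N ω₀ β K H T hT).support := by
  have := finite_support_uniformOfFinset (Finset.Icc 1 T) (Finset.nonempty_Icc.mpr hT)
  exact finite_support_bind _ _

theorem expect_pgLaw_zero (f : E d → EuclideanSpace ℝ (S × A) → ℝ) :
    (expect (M.pgLaw θ₀ α N ω₀ β K H 0) fun x => f x.θ x.r) =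
      expect (M.sgdOutput ω₀ β K H θ₀) fun w => f θ₀ (gradient M.F (M.linApprox w.1)) := by
  simp only [pgLaw, expect_bind, expect_pure]

theorem expect_pgLaw_succ (t : ℕ) (f : E d → EuclideanSpace ℝ (S × A) → ℝ) :
    (expect (M.pgLaw θ₀ α N ω₀ β K H (t + 1)) fun x => f x.θ x.r) =
      expect (M.pgLaw θ₀ α N ω₀ β K H t) fun x =>
        expect (M.sgdOutput ω₀ β K H x.θ) fun w =>
          expect (iid (M.trajLaw (M.policy x.θ) H) N) fun τ =>
            f (x.θ + α • M.batchEstimate τ x.θ x.r) (gradient M.F (M.linApprox w.1)) := by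
  simp only [pgLaw, expect_bind, expect_pure, batchEstimate, smul_smul, mul_one_div]

theorem expect_iterateLaw (t : ℕ) (f : E d → ℝ) :
    expect (M.iterateLaw θ₀ α N ω₀ β K H t) f =
      expect (M.pgLaw θ₀ α N ω₀ β K H t) fun x => f x.θ :=
  expect_map _ _ _

theorem expect_averageLaw (T : ℕ) (hT : 1 ≤ T) (f : E d → ℝ) :
    expect (M.averageLaw θ₀ α N ω₀ β K H T hT) f =
      1 / T * ∑ t ∈ Finset.Icc 1 T, expect (M.pgLaw θ₀ α N ω₀ β K H t) fun x => f x.θ := by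
  have := finite_support_uniformOfFinset (Finset.Icc 1 T) (Finset.nonempty_Icc.mpr hT)
  rw [averageLaw, expect_bind, expect_uniformOfFinset]
  simp only [Nat.card_Icc, Nat.add_sub_cancel, expect_iterateLaw]

end Laws

namespace IsRegular

variable {lψ Lψ lF LF LF₁ : ℝ} (h : M.IsRegular lψ Lψ lF LF LF₁)
  {α : ℝ} (hα_le : α ≤ maxStepSize M.γ lψ Lψ lF LF₁) {N : ℕ} (hN : N ≠ 0) (ω₀ : E m) (β : ℝ)
  (K H : ℕ)

include h hα_le hN

theorem expect_potential_step_le (hα : 0 ≤ α) (θ : E d) (r : EuclideanSpace ℝ (S × A)) :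
    (expect (M.sgdOutput ω₀ β K H θ) fun w =>
      expect (iid (M.trajLaw (M.policy θ) H) N) fun τ =>
        M.potential lψ α (θ + α • M.batchEstimate τ θ r) (gradient M.F (M.linApprox w.1))) ≤
      M.potential lψ α θ r - α / 2 * ‖gradient M.objective θ‖ ^ 2 +
        α / 2 * (estimateConst M.γ lψ * (lF ^ 2 * (M.γ ^ H + 1 / N))) +
        estimateConst M.γ lψ * α * expect (M.sgdOutput ω₀ β K H θ) fun w =>
          M.utilityError θ (gradient M.F (M.linApprox w.1)) ^ 2 := by
  have batch_le (w : E m × ℕ) :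
      (expect (iid (M.trajLaw (M.policy θ) H) N) fun τ =>
        M.potential lψ α (θ + α • M.batchEstimate τ θ r) (gradient M.F (M.linApprox w.1))) ≤
      (M.potential lψ α θ r - α / 2 * ‖gradient M.objective θ‖ ^ 2 +
        α / 2 * (estimateConst M.γ lψ * (lF ^ 2 * (M.γ ^ H + 1 / N)))) +
        estimateConst M.γ lψ * α * M.utilityError θ (gradient M.F (M.linApprox w.1)) ^ 2 := by
    refine (expect_mono _ fun τ => h.potential_step_le hα hα_le θ _ _).trans ?_
    rw [expect_add, expect_add, expect_const, expect_const, expect_mul]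
    have estimate_le := mul_le_mul_of_nonneg_left
      (h.expect_norm_batchEstimate_sub_gradient_sq_le H θ r hN) (by positivity : 0 ≤ α / 2)
    rw [potential]
    linarith
  refine (expect_mono _ batch_le).trans_eq ?_
  rw [expect_add, expect_const, expect_mul]

variable {δ : ℝ} {T : ℕ} {θ₀ : E d}
  (hδ : ∀ t < T, (expect (M.pgLaw θ₀ α N ω₀ β K H t) fun x =>
    expect (M.sgdOutput ω₀ β K H x.θ) fun w =>
      M.utilityError x.θ (gradient M.F (M.linApprox w.1)) ^ 2) ≤ δ)

include hδ

theorem expect_potential_pgLaw_succ_le (hα : 0 ≤ α) {t : ℕ} (ht : t < T) :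
    (expect (M.pgLaw θ₀ α N ω₀ β K H (t + 1)) fun x => M.potential lψ α x.θ x.r) ≤
      (expect (M.pgLaw θ₀ α N ω₀ β K H t) fun x => M.potential lψ α x.θ x.r) -
        α / 2 * (expect (M.pgLaw θ₀ α N ω₀ β K H t) fun x => ‖gradient M.objective x.θ‖ ^ 2) +
        (α / 2 * (estimateConst M.γ lψ * (lF ^ 2 * (M.γ ^ H + 1 / N))) +
          estimateConst M.γ lψ * α * δ) := by
  have step_le := expect_mono (M.pgLaw θ₀ α N ω₀ β K H t) fun x =>
    h.expect_potential_step_le hα_le hN ω₀ β K H hα x.θ x.r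
  rw [expect_add, expect_add, expect_const, expect_sub, expect_mul, expect_mul] at step_le
  rw [expect_pgLaw_succ]
  have error_le := mul_le_mul_of_nonneg_left (hδ t ht)
    (mul_nonneg (estimateConst_nonneg M.γ lψ) hα)
  linarith

theorem sum_expect_norm_gradient_sq_le (hα : 0 < α) (hT : 1 ≤ T) {Δ : ℝ}
    (hΔ : ∀ θ, M.objective θ ≤ M.objective θ₀ + Δ) :
    (∑ t ∈ Finset.range T,
      expect (M.pgLaw θ₀ α N ω₀ β K H t) fun x => ‖gradient M.objective x.θ‖ ^ 2) ≤
      2 * Δ / α + T * (estimateConst M.γ lψ * (lF ^ 2 * (M.γ ^ H + 1 / N)) +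
        3 * estimateConst M.γ lψ * δ) := by
  set W := estimateConst M.γ lψ
  have W_nonneg : 0 ≤ W := estimateConst_nonneg _ _
  have δ_nonneg : 0 ≤ δ :=
    (expect_nonneg _ fun x => expect_nonneg _ fun w => sq_nonneg _).trans (hδ 0 hT)
  have initial_le : (expect (M.pgLaw θ₀ α N ω₀ β K H 0) fun x => M.potential lψ α x.θ x.r) ≤
      W / 2 * α * δ - M.objective θ₀ := by
    have error_le := hδ 0 hT
    rw [expect_pgLaw_zero θ₀ α N ω₀ β K H fun θ _ => expect (M.sgdOutput ω₀ β K H θ) fun w =>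
      M.utilityError θ (gradient M.F (M.linApprox w.1)) ^ 2, expect_const] at error_le
    rw [expect_pgLaw_zero θ₀ α N ω₀ β K H (M.potential lψ α)]
    simp only [potential, expect_sub, expect_mul, expect_const]
    gcongr
  have le_final : -(M.objective θ₀ + Δ) ≤
      expect (M.pgLaw θ₀ α N ω₀ β K H T) fun x => M.potential lψ α x.θ x.r := by
    rw [← expect_const (M.pgLaw θ₀ α N ω₀ β K H T) (-(M.objective θ₀ + Δ))]
    refine expect_mono _ fun x => ?_
    have : 0 ≤ W / 2 * α * M.utilityError x.θ x.r ^ 2 := by positivity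
    rw [potential]
    linarith [hΔ x.θ]
  have telescoped := mul_sum_range_le_of_step_le
    (V := fun t => expect (M.pgLaw θ₀ α N ω₀ β K H t) fun x => M.potential lψ α x.θ x.r)
    (g := fun t => expect (M.pgLaw θ₀ α N ω₀ β K H t) fun x => ‖gradient M.objective x.θ‖ ^ 2)
    fun t => h.expect_potential_pgLaw_succ_le hα_le hN ω₀ β K H hδ hα.le (t := t)
  have first_le : W / 2 * α * δ ≤ T * (W / 2 * α * δ) :=
    le_mul_of_one_le_left (by positivity) (by exact_mod_cast hT)
  refine le_of_mul_le_mul_left ?_ (half_pos hα)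
  calc _ ≤ Δ + T * (α / 2 * (W * (lF ^ 2 * (M.γ ^ H + 1 / N))) + W * α * δ) +
        T * (W / 2 * α * δ) := by linarith
    _ = _ := by
      field_simp
      ring

end IsRegular

end Problem

theorem utilityErrorConst_nonneg (γ LF B : ℝ) {nA ρmin μ : ℝ} (hnA : 0 ≤ nA) (hρ : 0 < ρmin)
    (hμ : 0 < μ) : 0 ≤ utilityErrorConst γ LF nA ρmin B μ := by
  have := regressionConst_nonneg γ B hμ
  unfold utilityErrorConst
  positivity

theorem gradSqConst_nonneg (γ lψ lF LF B Δ : ℝ) {α nA ρmin μ : ℝ} (hα : 0 < α) (hnA : 0 ≤ nA)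
    (hρ : 0 < ρmin) (hμ : 0 < μ) : 0 ≤ gradSqConst γ lψ lF LF α nA ρmin B μ Δ := by
  have := utilityErrorConst_nonneg γ LF B hnA hρ hμ
  have := estimateConst_nonneg γ lψ
  unfold gradSqConst
  positivity

theorem one_div_le_of_div_sq_le {c ε x : ℝ} (hc : 0 < c) (hε : 0 < ε) (h : c / ε ^ 2 ≤ x) :
    1 / x ≤ ε ^ 2 / c := by
  simpa only [one_div_div] using one_div_le_one_div_of_le (by positivity) h

theorem log_one_div_pos {γ : ℝ} (hγ : γ ∈ Set.Ioo 0 1) : 0 < Real.log (1 / γ) :=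
  Real.log_pos ((one_lt_div hγ.1).mpr hγ.2)

theorem pow_le_sq_of_mul_log_le {γ ε : ℝ} (hγ : γ ∈ Set.Ioo 0 1) (hε : 0 < ε) {H : ℕ}
    (hH : 2 / Real.log (1 / γ) * Real.log (1 / ε) ≤ H) : γ ^ H ≤ ε ^ 2 := by
  rw [div_mul_eq_mul_div, div_le_iff₀ (log_one_div_pos hγ), one_div, one_div, Real.log_inv,
    Real.log_inv] at hH
  rw [← Real.log_le_log_iff (pow_pos hγ.1 H) (by positivity), Real.log_pow, Real.log_pow]
  push_cast
  linarith

theorem sqrt_sq_add_le {x y : ℝ} (hx : 0 ≤ x) (hy : 0 ≤ y) : √(x ^ 2 + y) ≤ x + √y := by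
  refine Real.sqrt_le_iff.mpr ⟨by positivity, ?_⟩
  rw [add_sq, Real.sq_sqrt hy]
  have : 0 ≤ 2 * x * √y := by positivity
  linarith

theorem one_div_add_pow_add_le {γ c ε e : ℝ} (hγ : γ ∈ Set.Ioo 0 1) (hc : 0 < c) (hε : 0 < ε)
    (he : 0 ≤ e) {T N K H : ℕ} (hT : c / ε ^ 2 ≤ T) (hN : c / ε ^ 2 ≤ N) (hK : c / ε ^ 2 ≤ K)
    (hH : 2 / Real.log (1 / γ) * Real.log (1 / ε) ≤ H) :
    1 / (T : ℝ) + 1 / N + 1 / K + γ ^ H + e ≤ (3 / c + 1) * (ε ^ 2 + e) := by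
  have : 0 ≤ 3 / c * e := by positivity
  calc 1 / (T : ℝ) + 1 / N + 1 / K + γ ^ H + e
      ≤ ε ^ 2 / c + ε ^ 2 / c + ε ^ 2 / c + ε ^ 2 + e := by
        gcongr ?_ + ?_ + ?_ + ?_ + e
        exacts [one_div_le_of_div_sq_le hc hε hT, one_div_le_of_div_sq_le hc hε hN,
          one_div_le_of_div_sq_le hc hε hK, pow_le_sq_of_mul_log_le hγ hε hH]
    _ = (3 / c + 1) * ε ^ 2 + e := by ring
    _ ≤ (3 / c + 1) * (ε ^ 2 + e) := by linarith

namespace Problem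

variable {S A : Type*} [Fintype S] [Fintype A] [DecidableEq S] [DecidableEq A] [Nonempty A]
  {d m : ℕ} {M : Problem S A d m}

section OutputGradient

variable {lψ Lψ lF LF LF₁ : ℝ} (h : M.IsRegular lψ Lψ lF LF LF₁) {B μ : ℝ}
  (hφ : M.FeatureRegular B μ) (hB : 0 < B) (hμ : 0 < μ) {ρmin : ℝ} (hρ_pos : 0 < ρmin)
  (hρ : ∀ s, ρmin ≤ (M.ρ s).toReal) {α : ℝ} {T N K H : ℕ} (hK : K ≠ 0) {θ₀ : E d} {e : ℝ}
  {w : E d → E m} (hw : ∀ θ ω, M.regLoss H θ (w θ) ≤ M.regLoss H θ ω)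
  (happrox : ∀ t < T, (expect (M.iterateLaw θ₀ α N 0 (1 / (8 * B ^ 2)) K H t) fun θ =>
    M.regLoss H θ (w θ)) ≤ e)

include h hφ hB hμ hρ_pos hρ hK hw happrox

theorem IsRegular.expect_pgLaw_utilityError_sq_le {t : ℕ} (ht : t < T) :
    (expect (M.pgLaw θ₀ α N 0 (1 / (8 * B ^ 2)) K H t) fun x =>
      expect (M.sgdOutput 0 (1 / (8 * B ^ 2)) K H x.θ) fun y =>
        M.utilityError x.θ (gradient M.F (M.linApprox y.1)) ^ 2) ≤
      utilityErrorConst M.γ LF (Fintype.card A) ρmin B μ * (e + 1 / K + M.γ ^ H) := by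
  have U_nonneg := utilityErrorConst_nonneg M.γ LF B (Nat.cast_nonneg (Fintype.card A)) hρ_pos hμ
  have loss_le := happrox t ht
  rw [expect_iterateLaw] at loss_le
  calc _ ≤ expect (M.pgLaw θ₀ α N 0 (1 / (8 * B ^ 2)) K H t) fun x =>
        utilityErrorConst M.γ LF (Fintype.card A) ρmin B μ *
          (M.regLoss H x.θ (w x.θ) + 1 / K + M.γ ^ H) :=
        expect_mono _ fun x => expect_utilityError_sgdOutput_sq_le hφ hB hμ h.discount_mem
          (hw x.θ) h.utility hρ_pos hρ hK
    _ ≤ _ := by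
        rw [expect_mul, expect_add, expect_add, expect_const, expect_const]
        gcongr

variable (hα : 0 < α) (hα_le : α ≤ maxStepSize M.γ lψ Lψ lF LF₁) {Δ : ℝ}
  (hΔ : ∀ θ, M.objective θ ≤ M.objective θ₀ + Δ) (hT : 1 ≤ T) (hN : N ≠ 0)

include hα hα_le hΔ hN

theorem IsRegular.expect_averageLaw_norm_gradient_sq_le :
    (expect (M.averageLaw θ₀ α N 0 (1 / (8 * B ^ 2)) K H T hT) fun θ =>
      ‖gradient M.objective θ‖ ^ 2) ≤
      gradSqConst M.γ lψ lF LF α (Fintype.card A) ρmin B μ Δ *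
        (1 / T + 1 / N + 1 / K + M.γ ^ H + e) := by
  set W := estimateConst M.γ lψ
  set U := utilityErrorConst M.γ LF (Fintype.card A) ρmin B μ
  set G := occGradBound M.γ lψ * lF
  have W_nonneg : 0 ≤ W := estimateConst_nonneg _ _
  have U_nonneg : 0 ≤ U :=
    utilityErrorConst_nonneg _ _ _ (Nat.cast_nonneg (Fintype.card A)) hρ_pos hμ
  have e_nonneg : 0 ≤ e :=
    (expect_nonneg _ fun θ => regLoss_nonneg H θ (w θ)).trans (happrox 0 hT)
  have pow_nonneg : 0 ≤ M.γ ^ H := pow_nonneg h.discount_mem.1.le H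
  have sum_le := h.sum_expect_norm_gradient_sq_le hα_le hN 0 (1 / (8 * B ^ 2)) K H
    (fun t ht => h.expect_pgLaw_utilityError_sq_le hφ hB hμ hρ_pos hρ hK hw happrox ht) hα hT hΔ
  have last_le : (expect (M.pgLaw θ₀ α N 0 (1 / (8 * B ^ 2)) K H T) fun x =>
      ‖gradient M.objective x.θ‖ ^ 2) ≤ G ^ 2 :=
    expect_le_const _ fun x =>
      pow_le_pow_left₀ (norm_nonneg _) (h.norm_gradient_objective_le x.θ) 2
  have Δ_le : 2 * Δ / α ≤ 2 * |Δ| / α := by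
    gcongr
    exact le_abs_self Δ
  rw [expect_averageLaw]
  calc _ ≤ 1 / (T : ℝ) * (2 * |Δ| / α +
        T * (W * (lF ^ 2 * (M.γ ^ H + 1 / N)) + 3 * W * (U * (e + 1 / K + M.γ ^ H))) + G ^ 2) := by
        gcongr
        exact (sum_Icc_le_sum_range_add (fun t => expect_nonneg _ fun x => sq_nonneg _) T).trans <|
          add_le_add (sum_le.trans (add_le_add_left Δ_le _)) last_le
    _ = (2 * |Δ| / α + G ^ 2) * (1 / T) + W * lF ^ 2 * (1 / N + M.γ ^ H) +
        3 * W * U * (1 / K + M.γ ^ H + e) := by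
        field_simp
        ring
    _ ≤ (2 * |Δ| / α + G ^ 2) * (1 / T + 1 / N + 1 / K + M.γ ^ H + e) +
        W * lF ^ 2 * (1 / T + 1 / N + 1 / K + M.γ ^ H + e) +
        3 * W * U * (1 / T + 1 / N + 1 / K + M.γ ^ H + e) := by
        have T_inv_nonneg : 0 ≤ 1 / (T : ℝ) := by positivity
        have N_inv_nonneg : 0 ≤ 1 / (N : ℝ) := by positivity
        have K_inv_nonneg : 0 ≤ 1 / (K : ℝ) := by positivity
        gcongr ?_ * ?_ + ?_ * ?_ + ?_ * ?_ <;> linarith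
    _ = _ := by
        rw [gradSqConst]
        ring

theorem IsRegular.expect_averageLaw_norm_gradient_le {c ε : ℝ} (hc : 0 < c) (hε : 0 < ε)
    (hTc : c / ε ^ 2 ≤ T) (hNc : c / ε ^ 2 ≤ N) (hKc : c / ε ^ 2 ≤ K)
    (hHc : 2 / Real.log (1 / M.γ) * Real.log (1 / ε) ≤ H) :
    (expect (M.averageLaw θ₀ α N 0 (1 / (8 * B ^ 2)) K H T hT) fun θ =>
      ‖gradient M.objective θ‖) ≤
      √(gradSqConst M.γ lψ lF LF α (Fintype.card A) ρmin B μ Δ * (3 / c + 1)) * (ε + √e) := by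
  set C := gradSqConst M.γ lψ lF LF α (Fintype.card A) ρmin B μ Δ
  have C_nonneg : 0 ≤ C :=
    gradSqConst_nonneg _ _ _ _ _ _ hα (Nat.cast_nonneg (Fintype.card A)) hρ_pos hμ
  have e_nonneg : 0 ≤ e :=
    (expect_nonneg _ fun θ => regLoss_nonneg H θ (w θ)).trans (happrox 0 hT)
  have mean_sq_le :
      (expect (M.averageLaw θ₀ α N 0 (1 / (8 * B ^ 2)) K H T hT) fun θ =>
        ‖gradient M.objective θ‖ ^ 2) ≤ C * (3 / c + 1) * (ε ^ 2 + e) := by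
    rw [mul_assoc]
    exact (h.expect_averageLaw_norm_gradient_sq_le hφ hB hμ hρ_pos hρ hK hw happrox hα hα_le hΔ hT
      hN).trans <| mul_le_mul_of_nonneg_left
        (one_div_add_pow_add_le h.discount_mem hc hε e_nonneg hTc hNc hKc hHc) C_nonneg
  calc _ ≤ √(C * (3 / c + 1) * (ε ^ 2 + e)) :=
        Real.le_sqrt_of_sq_le ((sq_expect_le _ _).trans mean_sq_le)
    _ = √(C * (3 / c + 1)) * √(ε ^ 2 + e) := Real.sqrt_mul' _ (by positivity)
    _ ≤ √(C * (3 / c + 1)) * (ε + √e) := by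
        gcongr
        exact sqrt_sq_add_le hε.le e_nonneg

end OutputGradient

section SampleCount

theorem sgdLaw_samples (ω₀ : E m) (β : ℝ) (H : ℕ) (θ : E d) (k : ℕ) :
    ∀ x ∈ (M.sgdLaw ω₀ β H θ k).support, x.samples = k * (H + 1) := by
  induction k with
  | zero => simp [sgdLaw]
  | succ k ih =>
    simp only [sgdLaw, PMF.mem_support_bind_iff, PMF.mem_support_pure_iff]
    rintro _ ⟨x, hx, p, -, τ, -, rfl⟩
    simp only [ih x hx, add_one_mul]

theorem sgdOutput_samples (ω₀ : E m) (β : ℝ) (K H : ℕ) (θ : E d) :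
    ∀ w ∈ (M.sgdOutput ω₀ β K H θ).support, w.2 = K * (H + 1) := by
  simp only [sgdOutput, PMF.mem_support_map_iff]
  rintro _ ⟨x, hx, rfl⟩
  exact sgdLaw_samples ω₀ β H θ K x hx

theorem pgLaw_samples (θ₀ : E d) (α : ℝ) (N : ℕ) (ω₀ : E m) (β : ℝ) (K H t : ℕ) :
    ∀ x ∈ (M.pgLaw θ₀ α N ω₀ β K H t).support,
      x.samples = K * (H + 1) + t * (K * (H + 1) + N * H) := by
  induction t with
  | zero =>
    simp only [pgLaw, PMF.mem_support_bind_iff, PMF.mem_support_pure_iff]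
    rintro _ ⟨w, hw, rfl⟩
    simp only [sgdOutput_samples _ _ _ _ _ w hw, zero_mul, add_zero]
  | succ t ih =>
    simp only [pgLaw, PMF.mem_support_bind_iff, PMF.mem_support_pure_iff]
    rintro _ ⟨x, hx, w, hw, τ, -, rfl⟩
    simp only [ih x hx, sgdOutput_samples _ _ _ _ _ w hw]
    ring

theorem samples_le_four_mul {N K H T : ℕ} (hT : 1 ≤ T) (hH : 1 ≤ H) (θ₀ : E d) (α : ℝ) (ω₀ : E m)
    (β : ℝ) : ∀ x ∈ (M.pgLaw θ₀ α N ω₀ β K H T).support, x.samples ≤ 4 * (T * (K + N) * H) := by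
  intro x hx
  calc x.samples = K * (H + 1) + T * (K * (H + 1) + N * H) := pgLaw_samples _ _ _ _ _ _ _ _ x hx
    _ ≤ T * (K * (H + H)) + T * (K * (H + H) + N * H) := by
        have query_le : K * (H + 1) ≤ K * (H + H) := by gcongr
        exact Nat.add_le_add (query_le.trans (Nat.le_mul_of_pos_left _ hT))
          (Nat.mul_le_mul_left T (Nat.add_le_add_right query_le _))
    _ = T * (4 * K + N) * H := by ring
    _ ≤ T * (4 * K + 4 * N) * H := by gcongr; lia
    _ = 4 * (T * (K + N) * H) := by ring

end SampleCount

end Problem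

theorem four_mul_mul_mul_le_of_le_div_sq {c C ε : ℝ} (hc : 0 < c) (hC : 8 * c ^ 3 ≤ C)
    {T N K H : ℕ} (hT : T ≤ c / ε ^ 2) (hN : N ≤ c / ε ^ 2) (hK : K ≤ c / ε ^ 2)
    (hH : H ≤ c * Real.log (1 / ε)) :
    4 * ((T : ℝ) * (K + N) * H) ≤ C * (1 / ε) ^ 4 * Real.log (1 / ε) := by
  have log_nonneg : 0 ≤ Real.log (1 / ε) :=
    nonneg_of_mul_nonneg_right ((Nat.cast_nonneg H).trans hH) hc
  calc 4 * ((T : ℝ) * (K + N) * H)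
      ≤ 4 * ((c / ε ^ 2) * (c / ε ^ 2 + c / ε ^ 2) * (c * Real.log (1 / ε))) := by gcongr
    _ = 8 * c ^ 3 * (1 / ε) ^ 4 * Real.log (1 / ε) := by ring
    _ ≤ C * (1 / ε) ^ 4 * Real.log (1 / ε) := by gcongr

end

end GenUtilityRL

theorem mainTheorem4
    (γ lψ Lψ lF LF LF₁ : ℝ) (hγ₀ : 0 < γ) (hγ₁ : γ < 1)
    (hlψ : 0 < lψ) (hLψ : 0 < Lψ) (hlF : 0 < lF) (hLF : 0 < LF) (hLF₁ : 0 < LF₁) :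
    -- a bound on the step size and the constant of the horizon
    ∃ α₀ > 0, ∃ cH > 0,
    ∀ (α : ℝ), 0 < α → α ≤ α₀ →
    -- the remaining constants of the problem, and the constants of the choice of `T, N, K, H`
    ∀ (nA m : ℕ) (ρmin B μ Δ c c' : ℝ), 0 < ρmin → 0 < B → 0 < μ → 0 < c → 0 < c' →
    -- the constant of all the estimates
    ∃ C > 0,
    ∀ (S A : Type*) [Fintype S] [Fintype A] [DecidableEq S] [DecidableEq A] [Nonempty A]
      (d : ℕ) (M : Problem S A d m) (θ₀ : E d),
      M.γ = γ → Fintype.card A = nA → (∀ s, ρmin ≤ (M.ρ s).toReal) →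
      M.PolicyRegular lψ Lψ → M.UtilityRegular lF LF LF₁ → M.FeatureRegular B μ →
      (∀ θ, M.objective θ ≤ M.objective θ₀ + Δ) →
      Differentiable ℝ M.objective ∧
      ∀ (ε : ℝ), 0 < ε →
      ∀ (T N K H : ℕ) (hT : 1 ≤ T), 1 ≤ N → 1 ≤ K → 1 ≤ H →
        c / ε ^ 2 ≤ T → c / ε ^ 2 ≤ N → c / ε ^ 2 ≤ K → cH * Real.log (1 / ε) ≤ H →
        -- the gradient bound, up to the approximation error
        (∀ (εapprox : ℝ) (ωstar : E d → E m),
          (∀ θ ω, M.regLoss H θ (ωstar θ) ≤ M.regLoss H θ ω) →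
          (∀ t < T, ∫ θ, M.regLoss H θ (ωstar θ)
            ∂(M.iterateLaw θ₀ α N 0 (1 / (8 * B ^ 2)) K H t).toMeasure ≤ εapprox) →
          ∫ θ, ‖gradient M.objective θ‖
            ∂(M.averageLaw θ₀ α N 0 (1 / (8 * B ^ 2)) K H T hT).toMeasure
              ≤ C * ε + C * Real.sqrt εapprox) ∧
        -- the sample complexity
        (ε ≤ 1 / 2 → T ≤ c' / ε ^ 2 → N ≤ c' / ε ^ 2 → K ≤ c' / ε ^ 2 →
          H ≤ c' * Real.log (1 / ε) →
          (T : ℝ) * (K + N) * H ≤ C * (1 / ε) ^ 4 * Real.log (1 / ε) ∧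
          ∀ x ∈ (M.pgLaw θ₀ α N 0 (1 / (8 * B ^ 2)) K H T).support,
            (x.samples : ℝ) ≤ C * (1 / ε) ^ 4 * Real.log (1 / ε)) := by
  have hγ : γ ∈ Set.Ioo 0 1 := ⟨hγ₀, hγ₁⟩
  refine ⟨maxStepSize γ lψ Lψ lF LF₁, maxStepSize_pos hγ hlψ.le hLψ.le hlF.le hLF₁.le,
    2 / Real.log (1 / γ), div_pos two_pos (log_one_div_pos hγ), ?_⟩
  intro α hα hα_le nA m ρmin B μ Δ c c' hρ_pos hB hμ hc hc'
  set R := √(gradSqConst γ lψ lF LF α nA ρmin B μ Δ * (3 / c + 1))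
  refine ⟨R + 8 * c' ^ 3, by positivity, ?_⟩
  rintro S A _ _ _ _ _ d M θ₀ rfl rfl hρ hψ hF hφ hΔ
  have h : M.IsRegular lψ Lψ lF LF LF₁ := ⟨hγ, hψ, hF, hLF₁.le⟩
  refine ⟨fun θ => (h.hasGradientAt_objective θ).differentiableAt, ?_⟩
  intro ε hε T N K H hT hN hK hH hTc hNc hKc hHc
  constructor
  · intro e w hw happrox
    simp only [integral_toMeasure_eq_expect] at happrox ⊢
    calc _ ≤ R * (ε + √e) :=
          h.expect_averageLaw_norm_gradient_le hφ hB hμ hρ_pos hρ (Nat.ne_of_gt hK) hw happrox hα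
            hα_le hΔ hT (Nat.ne_of_gt hN) hc hε hTc hNc hKc hHc
      _ ≤ (R + 8 * c' ^ 3) * (ε + √e) := by gcongr; exact le_add_of_nonneg_right (by positivity)
      _ = _ := mul_add _ _ _
  · intro _ hTc' hNc' hKc' hHc'
    have cost_le := four_mul_mul_mul_le_of_le_div_sq hc'
      (le_add_of_nonneg_left (Real.sqrt_nonneg _) : 8 * c' ^ 3 ≤ R + 8 * c' ^ 3) hTc' hNc' hKc' hHc'
    refine ⟨(le_mul_of_one_le_left (by positivity) (by norm_num)).trans cost_le,
      fun x hx => le_trans ?_ cost_le⟩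
    exact_mod_cast Problem.samples_le_four_mul hT hH θ₀ α 0 _ x hx
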